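/- **Setting.** An MDP has finite non-empty sets $\mathcal S,\mathcal A$ of states and actions, rewards $r\in\mathbb R^{\mathcal S\times\mathcal A\times\mathcal S}$, a discount factor $\gamma\in[0,1)$ and an initial law $\mu\in\Delta(\mathcal S)$. An *ambiguity-averse MDP* $\mathsf M$ consists of these data and a probability measure $\mathbb P_{\mathsf M}$ on the space $\Omega_{\mathsf M}=(\Delta(\mathcal S)^{\mathcal S\times\mathcal A})^{\mathbb N}$ of sequences $\tilde P=(\tilde P_t)_{t\in\mathbb N}$ of transition kernels. Given a probability measure $\nu$ on $\Delta(\mathcal S)^{\mathcal S\times\mathcal A}$, the kernels are *static* if $\tilde P_0\sim\nu$ and $\tilde P_t=\tilde P_0$ for all $t$, and *resampled* if $(\tilde P_t)_t$ is i.i.d. with law $\nu$. Let $\mathcal M_c$ be the class of all instances $(\mathcal S,\mathcal A,r,\nu,\gamma,\mu)$ such that the support of $\nu$ is convex and, for $P\sim\nu$, the components $P(s,\cdot,\cdot)$, $s\in\mathcal S$, are independent. A *risk measure* $\rho=(\rho_{\mathsf M})_{\mathsf M}$ assigns to each ambiguity-averse MDP $\mathsf M$ a map from the bounded random variables on $(\Omega_{\mathsf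 M},\mathbb P_{\mathsf M})$ to $\mathbb R$. Let $L^\infty_c(\mathbb R)$ be the set of all bounded random variables, on any of these probability spaces, whose law has convex support. On $L^\infty_c(\mathbb R)$, $\rho$ is *law-invariant* if two variables with the same law (possibly on different spaces) have the same value, *non-constant* if it takes at least two values, and *$W^1$-continuous* if $\rho(\tilde X_n)\to\rho(\tilde X)$ whenever $\tilde X_n,\tilde X\in L^\infty_c(\mathbb R)$ and the distribution functions $F_n$ of $\tilde X_n$ and $F$ of $\tilde X$ satisfy $\int_0^1|F_n^{-1}(u)-F^{-1}(u)|\,du\to0$. For a history-dependent policy $\pi\in\Pi_{\mathsf H}$ (randomized actions, depending on the history of states and actions) let $V^{\pi,\tilde P}(s)=\mathbb E^{\pi,\tilde P}_s\big[\sum_{t\ge0}\gamma^t r(\tilde S_t,\tilde A_t,\tilde S_{t+1})\big]$, the expectation being over trajectories only, and $V^{\pi,\nu,\rho}(s)=\rho(V^{\pi,\tilde P}(s))$, $V^{\nu,\rho}(s)=\sup_{\pi\in\Pi_{\mathsf H}}V^{\pi,\nu,\rho}(s)$. For a stationary policy $\pi\in\Pi_{\mathsf S}$ and $v\in\mathbb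 R^{\mathcal S}$ let $$T^{\pi,\nu,\rho}v(s)=\rho\Big(\sum_{a}\pi(s,a)\sum_{s'}\tilde P_0(s,a,s')\big(r(s,a,s')+\gamma v(s')\big)\Big),\qquad T^{\nu,\rho}v(s)=\sup_{\pi\in\Pi_{\mathsf S}}T^{\pi,\nu,\rho}v(s).$$ For static (resp. resampled) kernels, $\rho$ satisfies * (PE) if $V^{\pi,\nu,\rho}=T^{\pi,\nu,\rho}V^{\pi,\nu,\rho}$ for all instances in $\mathcal M_c$ and all $\pi\in\Pi_{\mathsf S}$; * (PO) if, for all instances in $\mathcal M_c$, $V^{\nu,\rho}$ and $T^{\nu,\rho}V^{\nu,\rho}$ are finite and $V^{\nu,\rho}=T^{\nu,\rho}V^{\nu,\rho}$. **Theorem.** Consider risk measures $\rho$ that are law-invariant, non-constant and $W^1$-continuous on $L^\infty_c(\mathbb R)$. 1. For static kernels, no such $\rho$ satisfies (PE), and no such $\rho$ satisfies (PO). 2. For resampled kernels, the only such $\rho$ satisfying (PE) is the expectation on $L^\infty_c(\mathbb R)$, and the only such $\rho$ satisfying (PO) is the expectation on $L^\infty_c(\mathbb R)$. That is, a risk measure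 $\rho$ is law-invariant, non-constant and $W^1$-continuous on $L^\infty_c(\mathbb R)$ and satisfies (PE) for resampled kernels if and only if $\rho(\tilde X)=\mathbb E(\tilde X)$ for all $\tilde X\in L^\infty_c(\mathbb R)$; and likewise with (PO) in place of (PE). -/

import Mathlib

open MeasureTheory ProbabilityTheory Filter Topology
open scoped ENNReal

namespace AmbiguityAverse

noncomputable section

/-! ### Finite distributions, transition kernels and policies -/

theorem simplex_nonneg {X : Type} [Fintype X] (p : stdSimplex ℝ X) (x : X) : 0 ≤ p x := p.2.1 x

theorem simplex_sum {X : Type} [Fintype X] (p : stdSimplex ℝ X) : ∑ x, p x = 1 := p.2.2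

/-- The measure `∑ x, p x • δ_x` on a finite set attached to a point `p` of the simplex. -/
def simplexMeasure {X : Type} [Fintype X] [MeasurableSpace X] (p : stdSimplex ℝ X) : Measure X :=
  ∑ x, ENNReal.ofReal (p x) • Measure.dirac x

instance simplexMeasure_isProbabilityMeasure {X : Type} [Fintype X] [MeasurableSpace X]
    (p : stdSimplex ℝ X) : IsProbabilityMeasure (simplexMeasure p) := by
  refine ⟨?_⟩
  simp only [simplexMeasure, Measure.coe_finsetSum, Finset.sum_apply, Measure.smul_apply,
    measure_univ, smul_eq_mul, mul_one]
  rw [← ENNReal.ofReal_sum_of_nonneg (fun x _ => simplex_nonneg p x), simplex_sum,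
    ENNReal.ofReal_one]

/-- Transition kernels: the elements of `Δ(S)^(S × A)`. -/
abbrev TransKernel (S A : Type) [Fintype S] : Type := S → A → stdSimplex ℝ S

/-- History-dependent policies: a policy maps every finite history
`(s₀, a₀, …, s_{t-1}, a_{t-1}, s_t)` to a distribution over actions. -/
abbrev HistoryPolicy (S A : Type) [Fintype A] : Type :=
  (t : ℕ) → (Fin t → S × A) → S → stdSimplex ℝ A

/-- Stationary policies. -/
abbrev StationaryPolicy (S A : Type) [Fintype A] : Type := S → stdSimplex ℝ A

/-- A stationary policy, seen as a history-dependent policy. -/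
def StationaryPolicy.toHistory {S A : Type} [Fintype A] (π : StationaryPolicy S A) :
    HistoryPolicy S A := fun _ _ s => π s

/-! ### The nominal Bellman operator -/

section Bellman

variable {S A : Type} [Fintype S]

theorem measurable_ofReal_apply (P₀ : ℕ × S × A) (s' : S) :
    Measurable fun P : ℕ → TransKernel S A => ENNReal.ofReal (P P₀.1 P₀.2.1 P₀.2.2 s') := by
  have h1 : Measurable fun P : ℕ → TransKernel S A => P P₀.1 P₀.2.1 P₀.2.2 := by fun_prop
  have h2 : Measurable fun p : stdSimplex ℝ S => p s' :=
    (measurable_pi_apply s').comp measurable_subtype_coe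
  exact ENNReal.measurable_ofReal.comp (h2.comp h1)

variable [Fintype A]

/-- The nominal Bellman operator `T^{π,P}`. -/
def nominalBellman (γ : ℝ) (r : S → A → S → ℝ) (π : StationaryPolicy S A) (P : TransKernel S A)
    (v : S → ℝ) (s : S) : ℝ :=
  ∑ a, π s a * ∑ s', P s a s' * (r s a s' + γ * v s')

/-- A bound for the absolute value of the rewards. -/
def rewardBound (r : S → A → S → ℝ) : ℝ := ∑ s, ∑ a, ∑ s', |r s a s'|

theorem abs_le_rewardBound (r : S → A → S → ℝ) (s : S) (a : A) (s' : S) :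
    |r s a s'| ≤ rewardBound r := by
  unfold rewardBound
  refine (Finset.single_le_sum (f := fun s' => |r s a s'|) (fun _ _ => abs_nonneg _)
    (Finset.mem_univ s')).trans ?_
  refine (Finset.single_le_sum (f := fun a => ∑ s', |r s a s'|)
    (fun _ _ => Finset.sum_nonneg fun _ _ => abs_nonneg _) (Finset.mem_univ a)).trans ?_
  exact Finset.single_le_sum (f := fun s => ∑ a, ∑ s', |r s a s'|)
    (fun _ _ => Finset.sum_nonneg fun _ _ => Finset.sum_nonneg fun _ _ => abs_nonneg _)
    (Finset.mem_univ s)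

theorem measurable_nominalBellman (γ : ℝ) (r : S → A → S → ℝ) (π : StationaryPolicy S A)
    (v : S → ℝ) (s : S) :
    Measurable fun P : TransKernel S A => nominalBellman γ r π P v s := by
  unfold nominalBellman
  refine Finset.measurable_sum _ fun a _ => Measurable.const_mul ?_ _
  refine Finset.measurable_sum _ fun s' _ => Measurable.mul_const ?_ _
  have h1 : Measurable fun P : TransKernel S A => P s a := by fun_prop
  exact ((measurable_pi_apply s').comp measurable_subtype_coe).comp h1

theorem abs_nominalBellman_le (γ : ℝ) (r : S → A → S → ℝ) (π : StationaryPolicy S A)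
    (P : TransKernel S A) (v : S → ℝ) (s : S) :
    |nominalBellman γ r π P v s| ≤ rewardBound fun s a s' => r s a s' + γ * v s' := by
  have hb := abs_le_rewardBound (fun s a s' => r s a s' + γ * v s')
  set R := rewardBound fun s a s' => r s a s' + γ * v s'
  have avg : ∀ {X : Type} [Fintype X] (p : stdSimplex ℝ X) (f : X → ℝ),
      (∀ x, |f x| ≤ R) → |∑ x, p x * f x| ≤ R := by
    intro X _ p f hf
    calc |∑ x, p x * f x| ≤ ∑ x, |p x * f x| := Finset.abs_sum_le_sum_abs _ _
      _ ≤ ∑ x, p x * R := Finset.sum_le_sum fun x _ => by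
          rw [abs_mul, abs_of_nonneg (simplex_nonneg p x)]
          exact mul_le_mul_of_nonneg_left (hf x) (simplex_nonneg p x)
      _ = R := by rw [← Finset.sum_mul, simplex_sum, one_mul]
  exact avg (π s) _ fun a => avg (P s a) _ fun s' => hb s a s'

end Bellman

/-! ### Trajectories and value functions -/

section Trajectories

variable {S A : Type} [Fintype S] [Fintype A] [MeasurableSpace S] [DiscreteMeasurableSpace S]
  [MeasurableSpace A] [DiscreteMeasurableSpace A]

/-- The law of a pair (state, action) when the state has law `m` and the action is drawn
from `d` at that state. -/
def stateActionLaw (m : Measure S) (d : S → stdSimplex ℝ A) : Measure (S × A) :=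
  m ⊗ₘ Kernel.ofFunOfCountable (fun s => simplexMeasure (d s))

instance (d : S → stdSimplex ℝ A) :
    IsMarkovKernel (Kernel.ofFunOfCountable (fun s => simplexMeasure (d s))) :=
  ⟨fun s => simplexMeasure_isProbabilityMeasure (d s)⟩

instance (m : Measure S) [IsProbabilityMeasure m] (d : S → stdSimplex ℝ A) :
    IsProbabilityMeasure (stateActionLaw m d) := by
  unfold stateActionLaw; infer_instance

/-- The past pairs `(s_i, a_i)`, `i < n + 1`, of a trajectory observed up to time `n`. -/
def pastPairs {n : ℕ} (h : (i : Finset.Iic n) → S × A) : Fin (n + 1) → S × A :=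
  fun i => h ⟨i, Finset.mem_Iic.2 (Nat.lt_succ_iff.1 i.2)⟩

/-- One step of the dynamics at time `n`: given the history `(s_0, a_0, …, s_n, a_n)`,
draw `s_{n+1}` from `P_n(s_n, a_n, ·)`, and then `a_{n+1}` from the policy. -/
def stepKernel (π : HistoryPolicy S A) (P : ℕ → TransKernel S A) (n : ℕ) :
    Kernel ((i : Finset.Iic n) → S × A) (S × A) :=
  Kernel.ofFunOfCountable fun h =>
    stateActionLaw
      (simplexMeasure (P n (h ⟨n, Finset.mem_Iic.2 le_rfl⟩).1 (h ⟨n, Finset.mem_Iic.2 le_rfl⟩).2))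
      (π (n + 1) (pastPairs h))

instance (π : HistoryPolicy S A) (P : ℕ → TransKernel S A) (n : ℕ) :
    IsMarkovKernel (stepKernel π P n) :=
  ⟨fun h => by
    change IsProbabilityMeasure (stateActionLaw _ _)
    infer_instance⟩

/-- The law of the trajectory `(S_t, A_t)_{t ∈ ℕ}` started at `s`, under the policy `π` and the
sequence `P` of transition kernels. -/
def trajectoryLaw (π : HistoryPolicy S A) (P : ℕ → TransKernel S A) (s : S) :
    Measure (ℕ → S × A) :=
  Kernel.trajMeasure (X := fun _ => S × A)
    (stateActionLaw (Measure.dirac s) (π 0 Fin.elim0)) (stepKernel π P)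

instance (π : HistoryPolicy S A) (P : ℕ → TransKernel S A) (s : S) :
    IsProbabilityMeasure (trajectoryLaw π P s) := by
  unfold trajectoryLaw; infer_instance

/-- The discounted return `∑ γ^t r(S_t, A_t, S_{t+1})` along a trajectory. -/
def discountedReturn (γ : ℝ) (r : S → A → S → ℝ) (x : ℕ → S × A) : ℝ :=
  ∑' t : ℕ, γ ^ t * r (x t).1 (x t).2 (x (t + 1)).1

/-- The nominal value function `V^{π,P}(s)`, the expected discounted return. -/
def nominalValue (γ : ℝ) (r : S → A → S → ℝ) (π : HistoryPolicy S A)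
    (P : ℕ → TransKernel S A) (s : S) : ℝ :=
  ∫ x, discountedReturn γ r x ∂(trajectoryLaw π P s)

theorem measurable_stepKernel_apply (π : HistoryPolicy S A) (n : ℕ)
    (h : (i : Finset.Iic n) → S × A) (y : S × A) :
    Measurable fun P : ℕ → TransKernel S A => stepKernel π P n h {y} := by
  change Measurable fun P : ℕ → TransKernel S A => stateActionLaw (simplexMeasure
    (P n (h ⟨n, Finset.mem_Iic.2 le_rfl⟩).1 (h ⟨n, Finset.mem_Iic.2 le_rfl⟩).2))
      (π (n + 1) (pastPairs h)) {y}
  simp only [stateActionLaw, Measure.compProd_apply (measurableSet_singleton y)]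
  simp only [simplexMeasure, lintegral_finsetSum_measure, lintegral_smul_measure, smul_eq_mul]
  refine Finset.measurable_sum _ fun x _ => Measurable.mul_const ?_ _
  exact measurable_ofReal_apply (n, h ⟨n, Finset.mem_Iic.2 le_rfl⟩) x

theorem measurable_trajectoryLaw_history (π : HistoryPolicy S A) (s : S) (n : ℕ)
    (h : (i : Finset.Iic n) → S × A) :
    Measurable fun P : ℕ → TransKernel S A =>
      trajectoryLaw π P s ((Preorder.frestrictLe (π := fun _ => S × A) n) ⁻¹' {h}) := by
  induction n with
  | zero =>
    have key : ∀ P : ℕ → TransKernel S A,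
        (trajectoryLaw π P s).map (Preorder.frestrictLe (π := fun _ => S × A) 0) =
        (stateActionLaw (Measure.dirac s) (π 0 Fin.elim0)).map
          (MeasurableEquiv.piUnique (fun _ : Finset.Iic 0 => S × A)).symm := by
      intro P
      rw [trajectoryLaw, Kernel.trajMeasure, Measure.map_comp _ _ (by fun_prop),
        Kernel.traj_map_frestrictLe, Kernel.partialTraj_self, Measure.id_comp]
    simp_rw [← Measure.map_apply (Preorder.measurable_frestrictLe (X := fun _ => S × A) 0)
      (measurableSet_singleton h), key]
    exact measurable_const
  | succ n ih =>
    let h' : (i : Finset.Iic n) → S × A := Preorder.frestrictLe₂ (π := fun _ => S × A) n.le_succ h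
    let y : S × A := h ⟨n + 1, Finset.mem_Iic.2 le_rfl⟩
    have hset : (Preorder.frestrictLe (π := fun _ => S × A) (n + 1)) ⁻¹' {h} =
        (fun x : ℕ → S × A => (Preorder.frestrictLe (π := fun _ => S × A) n x, x (n + 1))) ⁻¹'
          ({h'} ×ˢ {y}) := by
      ext x
      simp only [Set.mem_preimage, Set.mem_singleton_iff, Set.mem_prod]
      constructor
      · rintro rfl
        exact ⟨rfl, rfl⟩
      · rintro ⟨h1, h2⟩
        funext ⟨i, hi⟩
        rcases Nat.lt_or_eq_of_le (Finset.mem_Iic.1 hi) with hlt | rfl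
        · exact congrFun h1 ⟨i, Finset.mem_Iic.2 (Nat.lt_succ_iff.1 hlt)⟩
        · exact h2
    have key : ∀ P : ℕ → TransKernel S A,
        trajectoryLaw π P s ((Preorder.frestrictLe (π := fun _ => S × A) (n + 1)) ⁻¹' {h}) =
        stepKernel π P n h' {y} *
          trajectoryLaw π P s ((Preorder.frestrictLe (π := fun _ => S × A) n) ⁻¹' {h'}) := by
      intro P
      have hm : Measurable (fun x : ℕ → S × A =>
        (Preorder.frestrictLe (π := fun _ => S × A) n x, x (n + 1))) := by fun_prop
      rw [hset, ← Measure.map_apply hm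
        ((measurableSet_singleton h').prod (measurableSet_singleton y)), trajectoryLaw,
        ← Kernel.map_frestrictLe_trajMeasure_compProd_eq_map_trajMeasure,
        Measure.compProd_apply_prod (measurableSet_singleton h') (measurableSet_singleton y),
        lintegral_singleton, Measure.map_apply (by fun_prop) (measurableSet_singleton h')]
    simp_rw [key]
    exact (measurable_stepKernel_apply π n h' y).mul (ih h')

theorem measurable_trajectoryLaw (π : HistoryPolicy S A) (s : S) :
    Measurable fun P : ℕ → TransKernel S A => trajectoryLaw π P s := by
  refine Measurable.measure_of_isPiSystem_of_isProbabilityMeasure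
    (generateFrom_measurableCylinders (α := fun _ : ℕ => S × A)).symm
    isPiSystem_measurableCylinders ?_
  intro t ht
  rw [measurableCylinders_nat] at ht
  simp only [Set.mem_iUnion, Set.mem_singleton_iff] at ht
  obtain ⟨n, B, hB, rfl⟩ := ht
  have hset : ∀ P : ℕ → TransKernel S A, trajectoryLaw π P s (cylinder (Finset.Iic n) B) =
      ∑ h ∈ B.toFinite.toFinset,
        trajectoryLaw π P s ((Preorder.frestrictLe (π := fun _ => S × A) n) ⁻¹' {h}) := by
    intro P
    have hf : Measurable (Preorder.frestrictLe (π := fun _ : ℕ => S × A) n) := by fun_prop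
    simp_rw [← Measure.map_apply hf (measurableSet_singleton _)]
    rw [sum_measure_singleton, Set.Finite.coe_toFinset, Measure.map_apply hf hB]
    rfl
  simp_rw [hset]
  exact Finset.measurable_sum _ fun h _ => measurable_trajectoryLaw_history π s n h

theorem measurable_discountedReturn (γ : ℝ) (r : S → A → S → ℝ) :
    Measurable (discountedReturn γ r) := by
  unfold discountedReturn
  refine Measurable.tsum fun t => Measurable.const_mul ?_ _
  have h1 : Measurable fun z : (S × A) × (S × A) => r z.1.1 z.1.2 z.2.1 := measurable_of_countable _
  exact h1.comp (f := fun x : ℕ → S × A => (x t, x (t + 1))) (by fun_prop)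

theorem measurable_nominalValue (γ : ℝ) (r : S → A → S → ℝ) (π : HistoryPolicy S A) (s : S) :
    Measurable fun P : ℕ → TransKernel S A => nominalValue γ r π P s := by
  let κ : Kernel (ℕ → TransKernel S A) (ℕ → S × A) :=
    ⟨fun P => trajectoryLaw π P s, measurable_trajectoryLaw π s⟩
  have hκ : IsMarkovKernel κ :=
    ⟨fun P => by change IsProbabilityMeasure (trajectoryLaw π P s); infer_instance⟩
  exact (StronglyMeasurable.integral_kernel (κ := κ)
    (measurable_discountedReturn γ r).stronglyMeasurable).measurable

theorem abs_discountedReturn_le {γ : ℝ} (h0 : 0 ≤ γ) (h1 : γ < 1) (r : S → A → S → ℝ)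
    (x : ℕ → S × A) : |discountedReturn γ r x| ≤ (1 - γ)⁻¹ * rewardBound r := by
  rw [← Real.norm_eq_abs]
  refine tsum_of_norm_bounded ((hasSum_geometric_of_lt_one h0 h1).mul_right (rewardBound r))
    fun t => ?_
  rw [norm_mul, norm_pow, Real.norm_of_nonneg h0, Real.norm_eq_abs]
  exact mul_le_mul_of_nonneg_left (abs_le_rewardBound r _ _ _) (pow_nonneg h0 t)

theorem abs_nominalValue_le {γ : ℝ} (h0 : 0 ≤ γ) (h1 : γ < 1) (r : S → A → S → ℝ)
    (π : HistoryPolicy S A) (P : ℕ → TransKernel S A) (s : S) :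
    |nominalValue γ r π P s| ≤ (1 - γ)⁻¹ * rewardBound r := by
  have h := norm_integral_le_of_norm_le_const (μ := trajectoryLaw π P s)
    (f := discountedReturn γ r) (C := (1 - γ)⁻¹ * rewardBound r)
    (Eventually.of_forall fun x => abs_discountedReturn_le h0 h1 r x)
  simpa [nominalValue] using h

end Trajectories

/-! ### Ambiguity-averse MDPs -/

/-- The data `(S, A, r, γ, μ)` of a discounted MDP with finite state and action spaces. -/
structure MDPData where
  S : Type
  A : Type
  [fintypeS : Fintype S]
  [fintypeA : Fintype A]
  [nonemptyA : Nonempty A]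
  r : S → A → S → ℝ
  γ : ℝ
  γ_nonneg : 0 ≤ γ
  γ_lt_one : γ < 1
  μ : stdSimplex ℝ S

attribute [instance] MDPData.fintypeS MDPData.fintypeA MDPData.nonemptyA

instance (D : MDPData) : MeasurableSpace D.S := ⊤

instance (D : MDPData) : MeasurableSpace D.A := ⊤

instance (D : MDPData) : DiscreteMeasurableSpace D.S := ⟨fun _ => trivial⟩

instance (D : MDPData) : DiscreteMeasurableSpace D.A := ⟨fun _ => trivial⟩

/-- An ambiguity-averse MDP: the data of an MDP together with a distribution over the sequences
of transition kernels. The underlying probability space is the space of sequences of transition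
kernels, equipped with this distribution. -/
structure AmbiguityMDP where
  data : MDPData
  law : Measure (ℕ → TransKernel data.S data.A)
  [isProb : IsProbabilityMeasure law]

attribute [instance] AmbiguityMDP.isProb

/-- The two ways in which the sequence of transition kernels is sampled. -/
inductive KernelModel
  | static
  | resampled

/-- The law of the sequence of transition kernels: a single draw from `ν` that is repeated forever
(static kernels), or i.i.d. draws from `ν` (resampled kernels). -/
def KernelModel.pathLaw {S A : Type} [Fintype S] (k : KernelModel)
    (ν : Measure (TransKernel S A)) [IsProbabilityMeasure ν] : Measure (ℕ → TransKernel S A) :=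
  match k with
  | .static => ν.map fun P _ => P
  | .resampled => Measure.infinitePi fun _ : ℕ => ν

instance {S A : Type} [Fintype S] (k : KernelModel) (ν : Measure (TransKernel S A))
    [IsProbabilityMeasure ν] : IsProbabilityMeasure (k.pathLaw ν) := by
  cases k with
  | static =>
    exact Measure.isProbabilityMeasure_map (measurable_pi_lambda _ fun _ => measurable_id).aemeasurable
  | resampled =>
    change IsProbabilityMeasure (Measure.infinitePi fun _ : ℕ => ν)
    infer_instance

/-- The ambiguity-averse MDP with data `D` and static or resampled kernels of law `ν`. -/
def MDPData.withKernels (D : MDPData) (k : KernelModel) (ν : Measure (TransKernel D.S D.A))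
    [IsProbabilityMeasure ν] : AmbiguityMDP where
  data := D
  law := k.pathLaw ν

/-- The support of `ν`, as a measure on the vector space `ℝ^(S × A × S)`, is convex. -/
def HasConvexSupport {S A : Type} [Fintype S] (ν : Measure (TransKernel S A)) : Prop :=
  Convex ℝ (ν.map fun (P : TransKernel S A) (s : S) (a : A) (s' : S) => P s a s').support

/-- Under `ν`, the components `P(s, ·, ·)` of the kernel for different states `s` are
independent. -/
def HasProductStructure {S A : Type} [Fintype S] (ν : Measure (TransKernel S A)) : Prop :=
  iIndepFun (fun (s : S) (P : TransKernel S A) => P s) ν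

/-! ### Random variables and risk measures -/

/-- The bounded real random variables on the probability space of `M`. -/
def BoundedRV (M : AmbiguityMDP) : Type :=
  {X : (ℕ → TransKernel M.data.S M.data.A) → ℝ //
    Measurable X ∧ ∃ C : ℝ, ∀ᵐ P ∂M.law, |X P| ≤ C}

/-- The law of a random variable. -/
def BoundedRV.dist {M : AmbiguityMDP} (X : BoundedRV M) : Measure ℝ := M.law.map X.1

/-- `X` belongs to `L^∞_c(ℝ)`: the support of its law is convex. -/
def BoundedRV.ConvexSupport {M : AmbiguityMDP} (X : BoundedRV M) : Prop :=
  Convex ℝ X.dist.support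

/-- The expectation of a random variable. -/
def BoundedRV.expectation {M : AmbiguityMDP} (X : BoundedRV M) : ℝ := ∫ P, X.1 P ∂M.law

/-- A risk measure for ambiguity-averse MDPs: a family of real-valued maps, one on the bounded
random variables of each ambiguity-averse MDP. -/
def RiskMeasure : Type 1 := (M : AmbiguityMDP) → BoundedRV M → ℝ

/-- The quantile function `F⁻¹(u) = inf {x | u ≤ F(x)}` of a law with distribution function `F`. -/
def quantile (m : Measure ℝ) (u : ℝ) : ℝ := sInf {x : ℝ | u ≤ cdf m x}

/-- The Wasserstein-1 distance `∫₀¹ |F₁⁻¹(u) - F₂⁻¹(u)| du` of two laws with compact support. -/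
def wasserstein1 (m₁ m₂ : Measure ℝ) : ℝ :=
  ∫ u in (0 : ℝ)..1, |quantile m₁ u - quantile m₂ u|

namespace RiskMeasure

variable (ρ : RiskMeasure)

/-- Law-invariance on `L^∞_c(ℝ)`. -/
def LawInvariant : Prop :=
  ∀ (M M' : AmbiguityMDP) (X : BoundedRV M) (X' : BoundedRV M'),
    X.ConvexSupport → X'.ConvexSupport → X.dist = X'.dist → ρ M X = ρ M' X'

/-- Being non-constant on `L^∞_c(ℝ)`. -/
def NonConstant : Prop :=
  ∃ (M M' : AmbiguityMDP) (X : BoundedRV M) (X' : BoundedRV M'),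
    X.ConvexSupport ∧ X'.ConvexSupport ∧ ρ M X ≠ ρ M' X'

/-- `W¹`-continuity on `L^∞_c(ℝ)`: if the laws of the random variables `X n` converge to the law of
`X` in Wasserstein-1 distance, then the values of the risk measure converge. -/
def W1Continuous : Prop :=
  ∀ (M : AmbiguityMDP) (X : BoundedRV M) (N : ℕ → AmbiguityMDP) (Y : (n : ℕ) → BoundedRV (N n)),
    X.ConvexSupport → (∀ n, (Y n).ConvexSupport) →
    Tendsto (fun n => wasserstein1 (Y n).dist X.dist) atTop (𝓝 0) →
    Tendsto (fun n => ρ (N n) (Y n)) atTop (𝓝 (ρ M X))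

/-- `ρ` coincides with the expectation on `L^∞_c(ℝ)`. -/
def IsExpectation : Prop :=
  ∀ (M : AmbiguityMDP) (X : BoundedRV M), X.ConvexSupport → ρ M X = X.expectation

end RiskMeasure

/-! ### Ambiguity-averse value functions and Bellman operators -/

namespace AmbiguityMDP

variable (M : AmbiguityMDP)

/-- The random variable `V^{π,P}(s)`, where `P` is the random sequence of kernels. -/
def valueRV (π : HistoryPolicy M.data.S M.data.A) (s : M.data.S) : BoundedRV M :=
  ⟨fun P => nominalValue M.data.γ M.data.r π P s, measurable_nominalValue _ _ π s,
    _, Eventually.of_forall fun P =>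
      abs_nominalValue_le M.data.γ_nonneg M.data.γ_lt_one M.data.r π P s⟩

/-- The random variable `T^{π,P₀}v(s)`, where `P₀` is the random kernel of the first period. -/
def bellmanRV (π : StationaryPolicy M.data.S M.data.A) (v : M.data.S → ℝ) (s : M.data.S) :
    BoundedRV M :=
  ⟨fun P => nominalBellman M.data.γ M.data.r π (P 0) v s,
    (measurable_nominalBellman _ _ π v s).comp (measurable_pi_apply 0),
    _, Eventually.of_forall fun P => abs_nominalBellman_le M.data.γ M.data.r π (P 0) v s⟩

/-- The ambiguity-averse value function `V^{π,ν,ρ}` of a policy. -/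
def value (ρ : RiskMeasure) (π : HistoryPolicy M.data.S M.data.A) (s : M.data.S) : ℝ :=
  ρ M (M.valueRV π s)

/-- The optimal ambiguity-averse value function `V^{ν,ρ}`. -/
def optValue (ρ : RiskMeasure) (s : M.data.S) : ℝ :=
  ⨆ π : HistoryPolicy M.data.S M.data.A, M.value ρ π s

/-- The ambiguity-averse Bellman operator `T^{π,ν,ρ}`. -/
def bellman (ρ : RiskMeasure) (π : StationaryPolicy M.data.S M.data.A) (v : M.data.S → ℝ)
    (s : M.data.S) : ℝ :=
  ρ M (M.bellmanRV π v s)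

/-- The optimal ambiguity-averse Bellman operator `T^{ν,ρ}`. -/
def optBellman (ρ : RiskMeasure) (v : M.data.S → ℝ) (s : M.data.S) : ℝ :=
  ⨆ π : StationaryPolicy M.data.S M.data.A, M.bellman ρ π v s

end AmbiguityMDP

namespace RiskMeasure

variable (ρ : RiskMeasure)

/-- Bellman equations for policy evaluation, over all instances with static (resp. resampled)
kernels whose law has convex support and product structure. -/
def PolicyEvaluation (k : KernelModel) : Prop :=
  ∀ (D : MDPData) (ν : Measure (TransKernel D.S D.A)) [IsProbabilityMeasure ν],
    HasConvexSupport ν → HasProductStructure ν →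
    ∀ π : StationaryPolicy D.S D.A,
      (D.withKernels k ν).value ρ π.toHistory =
        (D.withKernels k ν).bellman ρ π ((D.withKernels k ν).value ρ π.toHistory)

/-- Bellman optimality equations, over all instances with static (resp. resampled) kernels whose
law has convex support and product structure. The first two clauses say that the suprema that
define the two sides are finite. -/
def PolicyOptimization (k : KernelModel) : Prop :=
  ∀ (D : MDPData) (ν : Measure (TransKernel D.S D.A)) [IsProbabilityMeasure ν],
    HasConvexSupport ν → HasProductStructure ν →
      (∀ s : D.S, BddAbove (Set.range fun π : HistoryPolicy D.S D.A =>
        (D.withKernels k ν).value ρ π s)) ∧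
      (∀ s : D.S, BddAbove (Set.range fun π : StationaryPolicy D.S D.A =>
        (D.withKernels k ν).bellman ρ π ((D.withKernels k ν).optValue ρ) s)) ∧
      (D.withKernels k ν).optValue ρ =
        (D.withKernels k ν).optBellman ρ ((D.withKernels k ν).optValue ρ)

end RiskMeasure

end

end AmbiguityAverse

namespace AmbiguityAverse

noncomputable section

/-! ### Supports of measures -/

/-! The necessity parts need only instances with a single action. There every policy is the same, so
evaluation and optimization both reduce to one evaluation equation, `SingleActionEvaluation`.

The main instance (`exists_averaging_instance`) has five states. From state 0 the process moves to 1
or 2 with known probability 1/2 each, earning `c`. From 1 and 2 it moves to absorbing states with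
rewards -C or C and random, independent probabilities. The values at 1 and 2 can thus have any
bounded laws with convex support, and the value at 0 is c + γ(X + Y)/2 with X, Y independent. The
Bellman operator at 0 sees only a constant, so ρ(c + γ(X + Y)/2) = ρ(c + γ(ρ(X) + ρ(Y))/2). States 1
and 2 are each visited at most once, so static and resampled kernels give the same equation
(`onLaw_average`).

If ρ moved some constant x, taking X = Y = x would make ρ on constants periodic with every period
γ(ρ(x) - x), 0 ≤ γ < 1, hence constant. The equation would then make ρ constant altogether. So a
non-constant ρ fixes constants (`onLaw_dirac`), and comparing two instances shows that ρ does not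
change when a law is replaced by the law of the average of two independent copies
(`onLaw_selfAverage`). Iterating keeps the mean and halves the variance, so the laws tend to a point
mass at the mean, and W¹-continuity forces ρ to be the expectation (`isExpectation`).

For static kernels even the expectation fails. In a loop with uniform survival probability q, the
value q/(1 - q/2) is nonlinear in q because the same q is used at every visit.

Conversely, for resampled kernels the first kernel is independent of the later ones. The expected
value therefore obeys the recursion of the MDP with the mean kernel (`meanValue_eq`), and both
equations become those of that MDP. All of this stays within laws of convex support: values are
continuous in the kernels, and the support of the law of the kernel sequence is connected. -/

theorem support_map_eq_closure_image {X Y : Type*} [TopologicalSpace X] [MeasurableSpace X]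
    [OpensMeasurableSpace X] [HereditarilyLindelofSpace X] [TopologicalSpace Y]
    [MeasurableSpace Y] [BorelSpace Y] (μ : Measure X) {f : X → Y} (hf : Continuous f) :
    (μ.map f).support = closure (f '' μ.support) := by
  refine Set.Subset.antisymm ?_ ?_
  · refine Measure.support_subset_of_isClosed isClosed_closure ?_
    rw [mem_ae_map_iff hf.measurable.aemeasurable isClosed_closure.measurableSet]
    filter_upwards [μ.support_mem_ae] with x hx
    exact subset_closure ⟨x, hx, rfl⟩
  · refine closure_minimal ?_ Measure.isClosed_support
    rintro _ ⟨x, hx, rfl⟩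
    rw [Measure.mem_support_iff_forall] at hx ⊢
    intro U hU
    exact (hx _ (hf.continuousAt hU)).trans_le
      (Measure.le_map_apply hf.measurable.aemeasurable U)

/-- A basic neighbourhood constrains finitely many coordinates, so its measure is a finite product
of positive factors. Countability of the index set makes "every coordinate lies in its support" an
almost sure event, which gives the other inclusion. -/
theorem support_infinitePi {ι : Type*} {X : ι → Type*} [∀ i, TopologicalSpace (X i)]
    [∀ i, MeasurableSpace (X i)] [∀ i, OpensMeasurableSpace (X i)]
    [∀ i, HereditarilyLindelofSpace (X i)] [Countable ι]
    (μ : ∀ i, Measure (X i)) [∀ i, IsProbabilityMeasure (μ i)] :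
    (Measure.infinitePi μ).support = Set.univ.pi fun i => (μ i).support := by
  refine Set.Subset.antisymm ?_ ?_
  · refine Measure.support_subset_of_isClosed
      (isClosed_set_pi fun i _ => Measure.isClosed_support) ?_
    have h : ∀ᵐ x ∂(Measure.infinitePi μ), ∀ i, x i ∈ (μ i).support := by
      rw [ae_all_iff]
      intro i
      exact (measurePreserving_eval_infinitePi μ i).quasiMeasurePreserving.ae
        (μ i).support_mem_ae
    filter_upwards [h] with x hx i _
    exact hx i
  · intro x hx
    rw [Measure.mem_support_iff_forall]
    intro U hU
    rw [nhds_pi, Filter.mem_pi'] at hU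
    obtain ⟨I, t, ht, hU⟩ := hU
    choose u hu using fun i => mem_nhds_iff.1 (ht i)
    refine lt_of_lt_of_le ?_
      (measure_mono ((Set.pi_mono fun i _ => (hu i).1).trans hU))
    rw [Measure.infinitePi_pi μ fun i _ => (hu i).2.1.measurableSet]
    refine pos_iff_ne_zero.2 (Finset.prod_ne_zero_iff.2 fun i _ => ?_)
    exact ((Measure.mem_support_iff_forall _).1 (hx i trivial) _
      ((hu i).2.1.mem_nhds (hu i).2.2)).ne'

/-! ### Splitting off the first coordinate of an i.i.d. sequence -/

/-- This is the independence of the first term of an i.i.d. sequence from its tail, together with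
the fact that the tail has the law of the whole sequence. -/
theorem infinitePi_nat_map_cons {X : Type*} [MeasurableSpace X] (ν : Measure X)
    [IsProbabilityMeasure ν] :
    (ν.prod (Measure.infinitePi fun _ : ℕ => ν)).map
      (fun z : X × (ℕ → X) => fun n => Nat.casesOn n z.1 z.2 : X × (ℕ → X) → ℕ → X) =
    Measure.infinitePi fun _ : ℕ => ν := by
  have hm : Measurable
      (fun z : X × (ℕ → X) => fun n => Nat.casesOn n z.1 z.2 : X × (ℕ → X) → ℕ → X) := by
    refine measurable_pi_lambda _ fun n => ?_
    cases n with
    | zero => exact measurable_fst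
    | succ n => exact (measurable_pi_apply n).comp measurable_snd
  refine Measure.eq_infinitePi _ fun s t ht => ?_
  obtain ⟨N, hN⟩ := s.exists_nat_subset_range
  -- Padding with `Set.univ` turns a box over `s` into a box over an initial range, from which
  -- coordinate 0 splits off.
  let T : ℕ → Set X := fun i => if i ∈ s then t i else Set.univ
  have hT : ∀ i, MeasurableSet (T i) := fun i => by
    by_cases hi : i ∈ s <;> simp [T, hi, ht i]
  have hpre : (fun z : X × (ℕ → X) => fun n => Nat.casesOn n z.1 z.2 : X × (ℕ → X) → ℕ → X) ⁻¹'
      ((s : Set ℕ).pi t) = T 0 ×ˢ ((Finset.range N : Set ℕ).pi fun i => T (i + 1)) := by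
    ext ⟨x, y⟩
    simp only [Set.mem_preimage, Set.mem_pi, Finset.mem_coe, Set.mem_prod, Finset.mem_range]
    constructor
    · intro h
      refine ⟨?_, fun i _ => ?_⟩
      · by_cases h0 : 0 ∈ s
        · simpa [T, h0] using h 0 h0
        · simp [T, h0]
      · by_cases h0 : i + 1 ∈ s
        · simpa [T, h0] using h _ h0
        · simp [T, h0]
    · rintro ⟨h0, h⟩ i hi
      cases i with
      | zero => simpa [T, hi] using h0
      | succ i =>
        have := h i (by have := Finset.mem_range.1 (hN hi); omega)
        simpa [T, hi] using this
  have hprod : ∏ i ∈ s, ν (t i) = ∏ i ∈ Finset.range (N + 1), ν (T i) := by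
    rw [← Finset.prod_subset (hN.trans (Finset.range_subset_range.2 N.le_succ))]
    · exact Finset.prod_congr rfl fun i hi => by simp [T, hi]
    · intro i _ hi
      simp [T, hi]
  rw [Measure.map_apply hm (.pi s.countable_toSet fun i _ => ht i), hpre, Measure.prod_prod,
    Measure.infinitePi_pi _ fun i _ => hT (i + 1), hprod, Finset.prod_range_succ', mul_comm]

/-! ### The one-step recursion of the nominal value function -/

/-- Since `X` is finite, every event about the coordinates up to `n` is a finite disjoint union of
initial segments, and these events generate the σ-algebra. -/
theorem ext_of_initialSegments {X : Type*} [Finite X] [MeasurableSpace X]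
    [DiscreteMeasurableSpace X] {μ ν : Measure (ℕ → X)} [IsProbabilityMeasure μ]
    [IsProbabilityMeasure ν]
    (h : ∀ (n : ℕ) (x : ℕ → X), μ {y | ∀ i ≤ n, y i = x i} = ν {y | ∀ i ≤ n, y i = x i}) :
    μ = ν := by
  refine ext_of_generate_finite _ (generateFrom_measurableCylinders (α := fun _ : ℕ => X)).symm
    isPiSystem_measurableCylinders ?_ (by simp)
  intro t ht
  rw [measurableCylinders_nat] at ht
  simp only [Set.mem_iUnion, Set.mem_singleton_iff] at ht
  obtain ⟨n, B, hB, rfl⟩ := ht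
  have hset : ∀ (κ : Measure (ℕ → X)), κ (cylinder (Finset.Iic n) B) =
      ∑ b ∈ B.toFinite.toFinset,
        κ ((Preorder.frestrictLe (π := fun _ => X) n) ⁻¹' {b}) := by
    intro κ
    have hf : Measurable (Preorder.frestrictLe (π := fun _ : ℕ => X) n) := by fun_prop
    simp_rw [← Measure.map_apply hf (measurableSet_singleton _)]
    rw [sum_measure_singleton, Set.Finite.coe_toFinset, Measure.map_apply hf hB]
    rfl
  rw [hset, hset]
  refine Finset.sum_congr rfl fun b _ => ?_
  -- Reading `b` at `min i n` extends it to a full sequence; only the indices up to `n` matter.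
  have hb : (Preorder.frestrictLe (π := fun _ => X) n) ⁻¹' {b} =
      {y : ℕ → X | ∀ i ≤ n, y i = b ⟨min i n, Finset.mem_Iic.2 (min_le_right _ _)⟩} := by
    ext y
    simp only [Set.mem_preimage, Set.mem_singleton_iff, Set.mem_ofPred_eq]
    constructor
    · rintro rfl i hi
      simp [hi]
    · intro hy
      funext ⟨i, hi⟩
      have := hy i (Finset.mem_Iic.1 hi)
      simpa [Finset.mem_Iic.1 hi] using this
  rw [hb]
  exact h n fun i => b ⟨min i n, Finset.mem_Iic.2 (min_le_right _ _)⟩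

section Trajectories

variable {S A : Type} [Fintype S] [Fintype A]

theorem simplexMeasure_singleton {X : Type} [Fintype X] [MeasurableSpace X]
    [DiscreteMeasurableSpace X] (p : stdSimplex ℝ X) (x : X) :
    simplexMeasure p {x} = ENNReal.ofReal (p x) := by
  classical
  simp [simplexMeasure, Finset.sum_apply, Set.indicator_apply]

/-- The continuation of a history-dependent policy after the first state-action pair `z`. -/
def HistoryPolicy.after (π : HistoryPolicy S A) (z : S × A) : HistoryPolicy S A :=
  fun t h => π (t + 1) (Fin.cons z h)

variable [MeasurableSpace S] [DiscreteMeasurableSpace S]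
  [MeasurableSpace A] [DiscreteMeasurableSpace A]

theorem stateActionLaw_singleton (m : Measure S) [SFinite m] (d : S → stdSimplex ℝ A)
    (z : S × A) : stateActionLaw m d {z} = ENNReal.ofReal (d z.1 z.2) * m {z.1} := by
  obtain ⟨s, a⟩ := z
  rw [stateActionLaw, ← Set.singleton_prod_singleton, Measure.compProd_apply_prod
    (measurableSet_singleton _) (measurableSet_singleton _), lintegral_singleton]
  change simplexMeasure (d s) {a} * _ = _
  rw [simplexMeasure_singleton]

theorem trajectoryLaw_initialSegment_zero (π : HistoryPolicy S A) (P : ℕ → TransKernel S A)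
    (s : S) (x : ℕ → S × A) :
    trajectoryLaw π P s {y | ∀ i ≤ 0, y i = x i} =
      ENNReal.ofReal (π 0 Fin.elim0 (x 0).1 (x 0).2) * Measure.dirac s {(x 0).1} := by
  have h0 : {y : ℕ → S × A | ∀ i ≤ 0, y i = x i} =
      (Preorder.frestrictLe (π := fun _ => S × A) 0) ⁻¹'
        {(fun i => x i : (i : Finset.Iic 0) → S × A)} := by
    ext y
    simp only [Set.mem_preimage, Set.mem_singleton_iff, Set.mem_ofPred_eq]
    constructor
    · intro h
      funext ⟨i, hi⟩
      exact h i (Finset.mem_Iic.1 hi)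
    · intro h i hi
      exact congrFun h ⟨i, Finset.mem_Iic.2 hi⟩
  rw [h0, ← Measure.map_apply (by fun_prop) (measurableSet_singleton _), trajectoryLaw,
    Kernel.trajMeasure, Measure.map_comp _ _ (by fun_prop), Kernel.traj_map_frestrictLe,
    Kernel.partialTraj_self, Measure.id_comp,
    Measure.map_apply (by fun_prop) (measurableSet_singleton _), ← stateActionLaw_singleton]
  congr 1
  ext z
  simp only [Set.mem_preimage, Set.mem_singleton_iff]
  constructor
  · intro h
    exact congrFun h ⟨0, Finset.mem_Iic.2 le_rfl⟩
  · rintro rfl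
    funext ⟨i, hi⟩
    obtain rfl : i = 0 := Nat.le_zero.1 (Finset.mem_Iic.1 hi)
    rfl

theorem trajectoryLaw_initialSegment_succ (π : HistoryPolicy S A) (P : ℕ → TransKernel S A)
    (s : S) (n : ℕ) (x : ℕ → S × A) :
    trajectoryLaw π P s {y | ∀ i ≤ n + 1, y i = x i} =
      ENNReal.ofReal (π (n + 1) (fun i => x i) (x (n + 1)).1 (x (n + 1)).2) *
        ENNReal.ofReal (P n (x n).1 (x n).2 (x (n + 1)).1) *
        trajectoryLaw π P s {y | ∀ i ≤ n, y i = x i} := by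
  let h : (i : Finset.Iic n) → S × A := fun i => x i
  have hset : {y : ℕ → S × A | ∀ i ≤ n, y i = x i} =
      (Preorder.frestrictLe (π := fun _ => S × A) n) ⁻¹' {h} := by
    ext y
    simp only [Set.mem_preimage, Set.mem_singleton_iff, Set.mem_ofPred_eq]
    constructor
    · intro h
      funext ⟨i, hi⟩
      exact h i (Finset.mem_Iic.1 hi)
    · intro h i hi
      exact congrFun h ⟨i, Finset.mem_Iic.2 hi⟩
  have hset' : {y : ℕ → S × A | ∀ i ≤ n + 1, y i = x i} =
      (fun y : ℕ → S × A => (Preorder.frestrictLe (π := fun _ => S × A) n y, y (n + 1))) ⁻¹'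
        ({h} ×ˢ {x (n + 1)}) := by
    have : {y : ℕ → S × A | ∀ i ≤ n + 1, y i = x i} =
      {y : ℕ → S × A | ∀ i ≤ n, y i = x i} ∩ {y | y (n + 1) = x (n + 1)} := by
      ext y
      simp only [Set.mem_inter_iff, Set.mem_ofPred_eq]
      refine ⟨fun h => ⟨fun i hi => h i (hi.trans n.le_succ), h _ le_rfl⟩, fun h i hi => ?_⟩
      rcases Nat.lt_or_eq_of_le hi with hlt | rfl
      · exact h.1 i (Nat.lt_succ_iff.1 hlt)
      · exact h.2
    rw [this, hset]
    rfl
  have hm : Measurable (fun y : ℕ → S × A =>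
      (Preorder.frestrictLe (π := fun _ => S × A) n y, y (n + 1))) := by fun_prop
  have hstep : stepKernel π P n h {x (n + 1)} =
      ENNReal.ofReal (π (n + 1) (fun i => x i) (x (n + 1)).1 (x (n + 1)).2) *
        ENNReal.ofReal (P n (x n).1 (x n).2 (x (n + 1)).1) := by
    change stateActionLaw (simplexMeasure (P n (x n).1 (x n).2)) (π (n + 1) (fun i => x i))
      {x (n + 1)} = _
    rw [stateActionLaw_singleton, simplexMeasure_singleton]
  rw [hset, hset', ← Measure.map_apply hm
    ((measurableSet_singleton h).prod (measurableSet_singleton _)), ← hstep, trajectoryLaw,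
    ← Kernel.map_frestrictLe_trajMeasure_compProd_eq_map_trajMeasure,
    Measure.compProd_apply_prod (measurableSet_singleton h) (measurableSet_singleton _),
    lintegral_singleton, Measure.map_apply (by fun_prop) (measurableSet_singleton h)]

/-- The trajectory that starts with `z` and goes on with `y`. -/
def consTrajectory (z : S × A) (y : ℕ → S × A) : ℕ → S × A := fun n => Nat.casesOn n z y

omit [Fintype S] [Fintype A] [DiscreteMeasurableSpace S] [DiscreteMeasurableSpace A] in
theorem measurable_consTrajectory (z : S × A) : Measurable (consTrajectory z) := by
  refine measurable_pi_lambda _ fun n => ?_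
  cases n with
  | zero => exact measurable_const
  | succ n => exact measurable_pi_apply n

/-- The joint weight of the first action and the second state. -/
def firstWeight (π : HistoryPolicy S A) (P : ℕ → TransKernel S A) (s : S) (w : A × S) : ℝ :=
  π 0 Fin.elim0 s w.1 * P 0 s w.1 w.2

omit [MeasurableSpace S] [DiscreteMeasurableSpace S]
  [MeasurableSpace A] [DiscreteMeasurableSpace A] in
theorem firstWeight_nonneg (π : HistoryPolicy S A) (P : ℕ → TransKernel S A) (s : S)
    (w : A × S) : 0 ≤ firstWeight π P s w :=
  mul_nonneg (simplex_nonneg _ _) (simplex_nonneg _ _)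

omit [MeasurableSpace S] [DiscreteMeasurableSpace S]
  [MeasurableSpace A] [DiscreteMeasurableSpace A] in
theorem sum_firstWeight (π : HistoryPolicy S A) (P : ℕ → TransKernel S A) (s : S) :
    ∑ w, firstWeight π P s w = 1 := by
  simp only [Fintype.sum_prod_type, firstWeight, ← Finset.mul_sum, simplex_sum, mul_one]

/-- Conditioning on the first action and the second state leaves a trajectory governed by the
continuation of the policy and the shifted kernels. Both sides give the same mass to segments of
length one and satisfy the same recursion in the length, so they agree on all initial segments. -/
theorem trajectoryLaw_eq_sum (π : HistoryPolicy S A) (P : ℕ → TransKernel S A) (s : S) :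
    trajectoryLaw π P s = ∑ w : A × S, ENNReal.ofReal (firstWeight π P s w) •
      (trajectoryLaw (π.after (s, w.1)) (fun n => P (n + 1)) w.2).map
        (consTrajectory (s, w.1)) := by
  classical
  set ν := ∑ w : A × S, ENNReal.ofReal (firstWeight π P s w) •
      (trajectoryLaw (π.after (s, w.1)) (fun n => P (n + 1)) w.2).map
        (consTrajectory (s, w.1)) with hν
  have hprob : ∀ w : A × S, IsProbabilityMeasure
      ((trajectoryLaw (π.after (s, w.1)) (fun n => P (n + 1)) w.2).map
        (consTrajectory (s, w.1))) := fun w =>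
    Measure.isProbabilityMeasure_map (measurable_consTrajectory _).aemeasurable
  have : IsProbabilityMeasure ν := by
    refine ⟨?_⟩
    simp only [hν, Measure.coe_finsetSum, Finset.sum_apply, Measure.smul_apply,
      measure_univ, smul_eq_mul, mul_one]
    rw [← ENNReal.ofReal_sum_of_nonneg (fun w _ => firstWeight_nonneg π P s w), sum_firstWeight,
      ENNReal.ofReal_one]
  have hmeas : ∀ (n : ℕ) (x : ℕ → S × A), MeasurableSet {y : ℕ → S × A | ∀ i ≤ n, y i = x i} := by
    intro n x
    have : {y : ℕ → S × A | ∀ i ≤ n, y i = x i} = (Set.Iic n).pi fun i => {x i} := by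
      ext y; simp [Set.mem_pi]
    rw [this]
    exact .pi (Set.to_countable _) fun i _ => measurableSet_singleton _
  have hnu : ∀ (n : ℕ) (x : ℕ → S × A), ν {y | ∀ i ≤ n, y i = x i} =
      ∑ w : A × S, ENNReal.ofReal (firstWeight π P s w) * if (s, w.1) = x 0 then
        trajectoryLaw (π.after (s, w.1)) (fun n => P (n + 1)) w.2
          {y | ∀ i < n, y i = x (i + 1)} else 0 := by
    intro n x
    simp only [hν, Measure.coe_finsetSum, Finset.sum_apply, Measure.smul_apply, smul_eq_mul,
      Measure.map_apply (measurable_consTrajectory _) (hmeas n x)]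
    refine Finset.sum_congr rfl fun w _ => ?_
    congr 1
    split_ifs with hw
    · congr 1
      ext y
      simp only [Set.mem_preimage, Set.mem_ofPred_eq]
      refine ⟨fun h i hi => h (i + 1) hi, fun h i hi => ?_⟩
      cases i with
      | zero => exact hw
      | succ i => exact h i hi
    · refine measure_mono_null (fun y hy => ?_) measure_empty
      exact hw (hy 0 (Nat.zero_le _))
  have hzero : ∀ (x : ℕ → S × A), trajectoryLaw π P s {y | ∀ i ≤ 0, y i = x i} =
      ν {y | ∀ i ≤ 0, y i = x i} := by
    intro x
    rw [trajectoryLaw_initialSegment_zero, hnu]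
    obtain ⟨⟨s₀, a₀⟩, hx⟩ : ∃ z, x 0 = z := ⟨_, rfl⟩
    simp only [hx, Prod.mk.injEq, not_lt_zero, IsEmpty.forall_iff, implies_true, Set.ofPred_true,
      measure_univ, Fintype.sum_prod_type]
    by_cases hs : s = s₀
    · subst hs
      simp only [true_and, mul_ite, mul_one, mul_zero]
      rw [Finset.sum_eq_single a₀ (fun a _ ha => by simp [ha]) (by simp)]
      simp only [if_true]
      rw [← ENNReal.ofReal_sum_of_nonneg (fun s' _ => firstWeight_nonneg π P s (a₀, s'))]
      simp [firstWeight, ← Finset.mul_sum]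
    · simp [hs]
  have hsucc : ∀ (n : ℕ) (x : ℕ → S × A), ν {y | ∀ i ≤ n + 1, y i = x i} =
      ENNReal.ofReal (π (n + 1) (fun i => x i) (x (n + 1)).1 (x (n + 1)).2) *
        ENNReal.ofReal (P n (x n).1 (x n).2 (x (n + 1)).1) * ν {y | ∀ i ≤ n, y i = x i} := by
    intro n x
    have hpast : ∀ k, (Fin.cons (x 0) (fun i : Fin k => x (i + 1)) : Fin (k + 1) → S × A) =
        fun i : Fin (k + 1) => x i := by
      intro k
      funext i
      refine Fin.cases rfl (fun i => ?_) i
      simp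
    -- For `n = 0` the transition probability comes from `firstWeight`; afterwards it comes from a
    -- step of the shifted trajectory law.
    cases n with
    | zero =>
      rw [← hzero, trajectoryLaw_initialSegment_zero, hnu]
      have hlt : ∀ y : ℕ → S × A, (∀ i < 0 + 1, y i = x (i + 1)) ↔ ∀ i ≤ 0, y i = x (i + 1) := by
        intro y; simp
      simp only [hlt, trajectoryLaw_initialSegment_zero (x := fun i => x (i + 1))]
      obtain ⟨⟨s₀, a₀⟩, hx⟩ : ∃ z, x 0 = z := ⟨_, rfl⟩
      by_cases hs : s = s₀
      · subst hs
        rw [Fintype.sum_prod_type,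
          Finset.sum_eq_single a₀ (fun a _ ha => by simp [ha, hx]) (by simp),
          Finset.sum_eq_single (x (0 + 1)).1 (fun s' _ hs' => by simp [hx, hs']) (by simp)]
        have h1 := hpast 0
        have h2 : (fun i : Fin 0 => x (i + 1)) = Fin.elim0 := funext fun i => i.elim0
        rw [h2, hx] at h1
        simp only [hx, if_true, HistoryPolicy.after, h1, firstWeight,
          ENNReal.ofReal_mul (simplex_nonneg _ _)]
        simp
        ring
      · simp [hx, hs]
    | succ n =>
      rw [hnu, hnu, Finset.mul_sum]
      refine Finset.sum_congr rfl fun w _ => ?_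
      split_ifs with hw
      · have hlt : ∀ m (y : ℕ → S × A),
            (∀ i < m + 1, y i = x (i + 1)) ↔ ∀ i ≤ m, y i = x (i + 1) := by
          intro m y; simp
        simp only [hlt]
        rw [trajectoryLaw_initialSegment_succ (x := fun i => x (i + 1))]
        simp only [HistoryPolicy.after, hw, hpast]
        ring
      · simp
  refine ext_of_initialSegments fun n x => ?_
  induction n with
  | zero => exact hzero x
  | succ n ih => rw [trajectoryLaw_initialSegment_succ, hsucc, ih]

/-- Needed to identify the successor state in the first reward when conditioning in
`nominalValue_eq`. -/
theorem ae_trajectoryLaw_start (π : HistoryPolicy S A) (P : ℕ → TransKernel S A) (s : S) :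
    ∀ᵐ y ∂(trajectoryLaw π P s), (y 0).1 = s := by
  rw [trajectoryLaw_eq_sum, ae_finsetSum_measure_iff]
  intro w _
  refine Measure.ae_smul_measure ?_ _
  refine (ae_map_iff (measurable_consTrajectory _).aemeasurable ?_).2
    (Eventually.of_forall fun _ => rfl)
  exact measurableSet_eq_fun ((measurable_pi_apply 0).fst) measurable_const

omit [MeasurableSpace S] [DiscreteMeasurableSpace S]
  [MeasurableSpace A] [DiscreteMeasurableSpace A] in
theorem discountedReturn_cons {γ : ℝ} (h0 : 0 ≤ γ) (h1 : γ < 1) (r : S → A → S → ℝ) (z : S × A)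
    (y : ℕ → S × A) :
    discountedReturn γ r (consTrajectory z y) =
      r z.1 z.2 (y 0).1 + γ * discountedReturn γ r y := by
  have hs : Summable fun t : ℕ => γ ^ t *
      r (consTrajectory z y t).1 (consTrajectory z y t).2 (consTrajectory z y (t + 1)).1 := by
    refine Summable.of_norm_bounded
      ((summable_geometric_of_lt_one h0 h1).mul_right (rewardBound r)) fun t => ?_
    rw [norm_mul, norm_pow, Real.norm_of_nonneg h0, Real.norm_eq_abs]
    exact mul_le_mul_of_nonneg_left (abs_le_rewardBound r _ _ _) (pow_nonneg h0 t)
  rw [discountedReturn, hs.tsum_eq_zero_add, discountedReturn, ← tsum_mul_left]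
  simp only [pow_zero, one_mul, pow_succ', mul_assoc]
  rfl

theorem integrable_discountedReturn {γ : ℝ} (h0 : 0 ≤ γ) (h1 : γ < 1) (r : S → A → S → ℝ)
    (μ : Measure (ℕ → S × A)) [IsFiniteMeasure μ] : Integrable (discountedReturn γ r) μ :=
  .of_bound (measurable_discountedReturn γ r).aestronglyMeasurable _
    (Eventually.of_forall fun x => abs_discountedReturn_le h0 h1 r x)

/-- The recursion holds for every sequence of kernels, with `P 0` separated from the shifted
sequence. Randomness of the kernels enters only later, so static and resampled kernels share it. -/
theorem nominalValue_eq {γ : ℝ} (h0 : 0 ≤ γ) (h1 : γ < 1) (r : S → A → S → ℝ)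
    (π : HistoryPolicy S A) (P : ℕ → TransKernel S A) (s : S) :
    nominalValue γ r π P s = ∑ a, π 0 Fin.elim0 s a * ∑ s', P 0 s a s' *
      (r s a s' + γ * nominalValue γ r (π.after (s, a)) (fun n => P (n + 1)) s') := by
  have hprob : ∀ w : A × S, IsProbabilityMeasure
      ((trajectoryLaw (π.after (s, w.1)) (fun n => P (n + 1)) w.2).map
        (consTrajectory (s, w.1))) := fun w =>
    Measure.isProbabilityMeasure_map (measurable_consTrajectory _).aemeasurable
  rw [nominalValue, trajectoryLaw_eq_sum, integral_finsetSum_measure fun w _ =>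
    (integrable_discountedReturn h0 h1 r _).smul_measure ENNReal.ofReal_ne_top,
    Fintype.sum_prod_type]
  refine Finset.sum_congr rfl fun a _ => ?_
  rw [Finset.mul_sum]
  refine Finset.sum_congr rfl fun s' _ => ?_
  rw [integral_smul_measure, ENNReal.toReal_ofReal (firstWeight_nonneg _ _ _ _),
    integral_map (measurable_consTrajectory _).aemeasurable
      (measurable_discountedReturn γ r).aestronglyMeasurable, firstWeight, smul_eq_mul, mul_assoc]
  congr 2
  have hae : (fun y => discountedReturn γ r (consTrajectory (s, a) y))
      =ᵐ[trajectoryLaw (π.after (s, a)) (fun n => P (n + 1)) s']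
      fun y => r s a s' + γ * discountedReturn γ r y := by
    filter_upwards [ae_trajectoryLaw_start (π.after (s, a)) (fun n => P (n + 1)) s'] with y hy
    rw [discountedReturn_cons h0 h1, hy]
  rw [integral_congr_ae hae, integral_add (integrable_const _)
    ((integrable_discountedReturn h0 h1 r _).const_mul γ), integral_const_mul]
  simp [nominalValue]

/-! ### Continuity of the nominal value in the transition kernels -/

/-- The expected discounted return of the first `n` periods. -/
def horizonValue (γ : ℝ) (r : S → A → S → ℝ) :
    ℕ → HistoryPolicy S A → (ℕ → TransKernel S A) → S → ℝ
  | 0, _, _, _ => 0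
  | n + 1, π, P, s => ∑ a, π 0 Fin.elim0 s a * ∑ s', P 0 s a s' *
      (r s a s' + γ * horizonValue γ r n (π.after (s, a)) (fun k => P (k + 1)) s')

omit [MeasurableSpace S] [DiscreteMeasurableSpace S]
  [MeasurableSpace A] [DiscreteMeasurableSpace A] in
theorem continuous_horizonValue (γ : ℝ) (r : S → A → S → ℝ) (n : ℕ) (π : HistoryPolicy S A)
    (s : S) : Continuous fun P => horizonValue γ r n π P s := by
  induction n generalizing π s with
  | zero => exact continuous_const
  | succ n ih =>
    simp only [horizonValue]
    refine continuous_finsetSum _ fun a _ => continuous_const.mul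
      (continuous_finsetSum _ fun s' _ => Continuous.mul ?_ (continuous_const.add
        (continuous_const.mul ((ih _ s').comp (by fun_prop)))))
    have h : Continuous fun P : ℕ → TransKernel S A => P 0 s a := by fun_prop
    exact (continuous_apply s').comp (continuous_subtype_val.comp h)

omit [MeasurableSpace S] [DiscreteMeasurableSpace S]
  [MeasurableSpace A] [DiscreteMeasurableSpace A] [Fintype S] [Fintype A] in
theorem abs_sum_simplex_mul_le {X : Type} [Fintype X] (p : stdSimplex ℝ X) {f : X → ℝ} {R : ℝ}
    (hf : ∀ x, |f x| ≤ R) : |∑ x, p x * f x| ≤ R :=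
  calc |∑ x, p x * f x| ≤ ∑ x, |p x * f x| := Finset.abs_sum_le_sum_abs _ _
    _ ≤ ∑ x, p x * R := Finset.sum_le_sum fun x _ => by
        rw [abs_mul, abs_of_nonneg (simplex_nonneg p x)]
        exact mul_le_mul_of_nonneg_left (hf x) (simplex_nonneg p x)
    _ = R := by rw [← Finset.sum_mul, simplex_sum, one_mul]

theorem abs_nominalValue_sub_horizonValue_le {γ : ℝ} (h0 : 0 ≤ γ) (h1 : γ < 1)
    (r : S → A → S → ℝ) (n : ℕ) (π : HistoryPolicy S A) (P : ℕ → TransKernel S A) (s : S) :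
    |nominalValue γ r π P s - horizonValue γ r n π P s| ≤
      γ ^ n * ((1 - γ)⁻¹ * rewardBound r) := by
  induction n generalizing π P s with
  | zero => simpa [horizonValue] using abs_nominalValue_le h0 h1 r π P s
  | succ n ih =>
    rw [nominalValue_eq h0 h1, horizonValue, ← Finset.sum_sub_distrib]
    simp only [← mul_sub, ← Finset.sum_sub_distrib, add_sub_add_left_eq_sub]
    refine abs_sum_simplex_mul_le _ fun a => abs_sum_simplex_mul_le _ fun s' => ?_
    rw [abs_mul, abs_of_nonneg h0, pow_succ', mul_assoc]
    exact mul_le_mul_of_nonneg_left (ih _ _ _) h0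

/-- Discounting makes the finite-horizon values, which are built from finitely many coordinates by
sums and products, converge uniformly in `P`. -/
theorem continuous_nominalValue {γ : ℝ} (h0 : 0 ≤ γ) (h1 : γ < 1) (r : S → A → S → ℝ)
    (π : HistoryPolicy S A) (s : S) : Continuous fun P => nominalValue γ r π P s := by
  have hlim : Tendsto (fun n : ℕ => γ ^ n * ((1 - γ)⁻¹ * rewardBound r)) atTop (𝓝 0) := by
    simpa using (tendsto_pow_atTop_nhds_zero_of_lt_one h0 h1).mul_const _
  refine TendstoUniformly.continuous (F := fun n P => horizonValue γ r n π P s) (p := atTop) ?_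
    (Frequently.of_forall fun n => continuous_horizonValue γ r n π s)
  rw [Metric.tendstoUniformly_iff]
  intro ε hε
  filter_upwards [hlim.eventually_lt_const hε] with n hn P
  exact (abs_nominalValue_sub_horizonValue_le h0 h1 r n π P s).trans_lt hn

end Trajectories

/-! ### Laws of value functions have convex support -/

/-- A transition kernel as a point of the vector space `ℝ^(S × A × S)`. -/
def TransKernel.toFun {S A : Type} [Fintype S] (P : TransKernel S A) : S → A → S → ℝ :=
  fun s a s' => P s a s'

theorem TransKernel.continuous_toFun {S A : Type} [Fintype S] :
    Continuous (TransKernel.toFun : TransKernel S A → S → A → S → ℝ) := by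
  refine continuous_pi fun s => continuous_pi fun a => ?_
  exact continuous_subtype_val.comp ((continuous_apply a).comp (continuous_apply s))

theorem TransKernel.injective_toFun {S A : Type} [Fintype S] :
    Function.Injective (TransKernel.toFun : TransKernel S A → S → A → S → ℝ) := by
  intro P Q h
  funext s a
  exact Subtype.ext (congrFun (congrFun h s) a)

instance {S A : Type} [Fintype S] : CompactSpace (TransKernel S A) := by
  have : CompactSpace (stdSimplex ℝ S) :=
    isCompact_iff_compactSpace.1 (isCompact_stdSimplex ℝ S)
  unfold TransKernel
  infer_instance

instance {S A : Type} [Fintype S] [Fintype A] : SecondCountableTopology (TransKernel S A) := by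
  unfold TransKernel
  infer_instance

instance {S A : Type} [Fintype S] [Fintype A] : BorelSpace (TransKernel S A) := by
  unfold TransKernel
  infer_instance

instance {S A : Type} [Fintype S] [Fintype A] : BorelSpace (ℕ → TransKernel S A) :=
  Pi.borelSpace

/-- By compactness `TransKernel.toFun` is a closed embedding, so connectedness of the convex support
in the vector space pulls back to the space of kernels. -/
theorem HasConvexSupport.isPreconnected {S A : Type} [Fintype S] [Fintype A]
    {ν : Measure (TransKernel S A)} (h : HasConvexSupport ν) : IsPreconnected ν.support := by
  have hs : (ν.map TransKernel.toFun).support = TransKernel.toFun '' ν.support := by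
    rw [support_map_eq_closure_image ν TransKernel.continuous_toFun, IsClosed.closure_eq]
    exact (Measure.isClosed_support.isCompact.image TransKernel.continuous_toFun).isClosed
  have hind : IsInducing (TransKernel.toFun : TransKernel S A → S → A → S → ℝ) :=
    (TransKernel.continuous_toFun.isClosedEmbedding TransKernel.injective_toFun).isInducing
  rw [← hind.isPreconnected_image, ← hs]
  exact Convex.isPreconnected h

theorem KernelModel.isPreconnected_support_pathLaw {S A : Type} [Fintype S] [Fintype A]
    (k : KernelModel) {ν : Measure (TransKernel S A)} [IsProbabilityMeasure ν]
    (h : HasConvexSupport ν) : IsPreconnected (k.pathLaw ν).support := by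
  cases k with
  | static =>
    have hc : Continuous fun (P : TransKernel S A) (_ : ℕ) => P := by fun_prop
    change IsPreconnected (ν.map fun P (_ : ℕ) => P).support
    rw [support_map_eq_closure_image ν hc]
    exact (h.isPreconnected.image _ hc.continuousOn).closure
  | resampled =>
    change IsPreconnected (Measure.infinitePi fun _ : ℕ => ν).support
    rw [support_infinitePi]
    exact isPreconnected_univ_pi fun _ => h.isPreconnected

/-- On the line convex means connected, and the support of the law is the closure of a continuous
image of a connected set. This places all values and Bellman updates in L^∞_c. -/
theorem BoundedRV.convexSupport_of_continuous {M : AmbiguityMDP}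
    (hM : IsPreconnected M.law.support) {X : BoundedRV M} (hX : Continuous X.1) :
    X.ConvexSupport := by
  rw [BoundedRV.ConvexSupport, BoundedRV.dist, support_map_eq_closure_image _ hX]
  exact Real.convex_iff_isPreconnected.2 (hM.image _ hX.continuousOn).closure

theorem convexSupport_valueRV (D : MDPData) (k : KernelModel) {ν : Measure (TransKernel D.S D.A)}
    [IsProbabilityMeasure ν] (h : HasConvexSupport ν) (π : HistoryPolicy D.S D.A) (s : D.S) :
    ((D.withKernels k ν).valueRV π s).ConvexSupport :=
  BoundedRV.convexSupport_of_continuous (k.isPreconnected_support_pathLaw h)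
    (continuous_nominalValue D.γ_nonneg D.γ_lt_one D.r π s)

theorem continuous_nominalBellman {S A : Type} [Fintype S] [Fintype A] (γ : ℝ)
    (r : S → A → S → ℝ) (π : StationaryPolicy S A) (v : S → ℝ) (s : S) :
    Continuous fun P : TransKernel S A => nominalBellman γ r π P v s := by
  refine continuous_finsetSum _ fun a _ => continuous_const.mul
    (continuous_finsetSum _ fun s' _ => Continuous.mul ?_ continuous_const)
  exact (continuous_apply s').comp
    (continuous_subtype_val.comp ((continuous_apply a).comp (continuous_apply s)))

theorem convexSupport_bellmanRV (D : MDPData) (k : KernelModel)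
    {ν : Measure (TransKernel D.S D.A)} [IsProbabilityMeasure ν] (h : HasConvexSupport ν)
    (π : StationaryPolicy D.S D.A) (v : D.S → ℝ) (s : D.S) :
    ((D.withKernels k ν).bellmanRV π v s).ConvexSupport :=
  BoundedRV.convexSupport_of_continuous (k.isPreconnected_support_pathLaw h)
    ((continuous_nominalBellman D.γ D.r π v s).comp (continuous_apply 0))

theorem KernelModel.map_eval_pathLaw {S A : Type} [Fintype S] (k : KernelModel)
    (ν : Measure (TransKernel S A)) [IsProbabilityMeasure ν] (n : ℕ) :
    (k.pathLaw ν).map (fun P => P n) = ν := by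
  cases k with
  | static =>
    change (ν.map fun P (_ : ℕ) => P).map (fun P => P n) = ν
    have h : Measurable fun (P : TransKernel S A) (_ : ℕ) => P :=
      measurable_pi_lambda _ fun _ => measurable_id
    rw [Measure.map_map (measurable_pi_apply n) h]
    exact Measure.map_id
  | resampled => exact Measure.infinitePi_map_eval (fun _ : ℕ => ν) n

/-! ### Wasserstein distance and the quantile transform -/

/-- A law on the real line with bounded convex support. -/
structure IsConvexLaw (m : Measure ℝ) : Prop where
  isProb : IsProbabilityMeasure m
  bounded : ∃ C : ℝ, ∀ᵐ x ∂m, |x| ≤ C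
  convex : Convex ℝ m.support

/-- The infimum is attained by right continuity of the distribution function. Keeping `u` strictly
between 0 and 1 makes the set nonempty and bounded below. -/
theorem quantile_le_iff {m : Measure ℝ} [IsProbabilityMeasure m] {u : ℝ} (hu0 : 0 < u)
    (hu1 : u < 1) (x : ℝ) : quantile m u ≤ x ↔ u ≤ cdf m x := by
  have hbdd : BddBelow {x : ℝ | u ≤ cdf m x} := by
    obtain ⟨b, hb⟩ := ((tendsto_cdf_atBot m).eventually_lt_const hu0).exists
    exact ⟨b, fun y hy => le_of_not_gt fun hyb =>
      (hb.trans_le (hy.trans (monotone_cdf m hyb.le))).false⟩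
  have hne : {x : ℝ | u ≤ cdf m x}.Nonempty := by
    obtain ⟨b, hb⟩ := ((tendsto_cdf_atTop m).eventually_const_lt hu1).exists
    exact ⟨b, hb.le⟩
  refine ⟨fun h => ?_, fun h => csInf_le hbdd h⟩
  have hright : ContinuousWithinAt (cdf m) (Set.Ioi x) x :=
    (cdf m).right_continuous x |>.mono Set.Ioi_subset_Ici_self
  refine ge_of_tendsto hright ?_
  filter_upwards [self_mem_nhdsWithin] with y hy
  obtain ⟨z, hz, hzy⟩ := exists_lt_of_csInf_lt hne (lt_of_le_of_lt h hy)
  exact le_trans hz (monotone_cdf m hzy.le)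

theorem monotoneOn_quantile {m : Measure ℝ} [IsProbabilityMeasure m] :
    MonotoneOn (quantile m) (Set.Ioo 0 1) := fun u hu v hv huv => by
  rw [quantile_le_iff hu.1 hu.2]
  exact huv.trans ((quantile_le_iff hv.1 hv.2 _).1 le_rfl)

/-- Inverse transform sampling: by `quantile_le_iff`, the quantile of a uniform variable is at most
`x` exactly when that variable is at most `cdf m x`. -/
theorem map_quantile (m : Measure ℝ) [IsProbabilityMeasure m] :
    ((volume : Measure ℝ).restrict (Set.Ioo 0 1)).map (quantile m) = m := by
  have hvol : IsProbabilityMeasure ((volume : Measure ℝ).restrict (Set.Ioo 0 1)) :=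
    ⟨by simp⟩
  have hmeas : AEMeasurable (quantile m) ((volume : Measure ℝ).restrict (Set.Ioo 0 1)) :=
    aemeasurable_restrict_of_monotoneOn measurableSet_Ioo monotoneOn_quantile
  have := Measure.isProbabilityMeasure_map hmeas
  refine Measure.ext_of_Iic _ _ fun x => ?_
  rw [Measure.map_apply_of_aemeasurable hmeas measurableSet_Iic,
    Measure.restrict_apply₀' measurableSet_Ioo.nullMeasurableSet, ← ofReal_cdf]
  have hset : quantile m ⁻¹' Set.Iic x ∩ Set.Ioo 0 1 = Set.Iic (cdf m x) ∩ Set.Ioo 0 1 := by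
    ext u
    simp only [Set.mem_inter_iff, Set.mem_preimage, Set.mem_Iic]
    exact and_congr_left fun hu => quantile_le_iff hu.1 hu.2 x
  have hae : (Set.Iic (cdf m x) ∩ Set.Ioo 0 1 : Set ℝ) =ᵐ[volume]
      (Set.Iic (cdf m x) ∩ Set.Ioc 0 1 : Set ℝ) :=
    (ae_eq_refl _).inter Ioo_ae_eq_Ioc
  have hIoc : Set.Iic (cdf m x) ∩ Set.Ioc 0 1 = Set.Ioc 0 (cdf m x) := by
    ext u
    simp only [Set.mem_inter_iff, Set.mem_Iic, Set.mem_Ioc]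
    have := cdf_le_one m x
    constructor
    · rintro ⟨h1, h2, _⟩; exact ⟨h2, h1⟩
    · rintro ⟨h1, h2⟩; exact ⟨h2, h1, h2.trans this⟩
  rw [hset, measure_congr hae, hIoc, Real.volume_Ioc, sub_zero]

theorem aemeasurable_quantile (m : Measure ℝ) [IsProbabilityMeasure m] :
    AEMeasurable (quantile m) ((volume : Measure ℝ).restrict (Set.Ioo 0 1)) :=
  aemeasurable_restrict_of_monotoneOn measurableSet_Ioo monotoneOn_quantile

theorem integrable_quantile {m : Measure ℝ} [IsProbabilityMeasure m]
    (hm : Integrable (fun x => x) m) :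
    Integrable (quantile m) ((volume : Measure ℝ).restrict (Set.Ioo 0 1)) := by
  have h := hm
  rw [← map_quantile m] at h
  exact (integrable_map_measure (f := quantile m) aestronglyMeasurable_id
    (aemeasurable_quantile m)).1 h

theorem integral_quantile (m : Measure ℝ) [IsProbabilityMeasure m] (g : ℝ → ℝ)
    (hg : AEStronglyMeasurable g m) :
    ∫ u in Set.Ioo 0 1, g (quantile m u) = ∫ x, g x ∂m := by
  conv_rhs => rw [← map_quantile m]
  rw [integral_map (aemeasurable_quantile m)]
  rwa [map_quantile m]

theorem wasserstein1_eq (m₁ m₂ : Measure ℝ) : wasserstein1 m₁ m₂ =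
    ∫ u in Set.Ioo 0 1, |quantile m₁ u - quantile m₂ u| := by
  rw [wasserstein1, intervalIntegral.integral_of_le zero_le_one, integral_Ioc_eq_integral_Ioo]

theorem abs_integral_sub_le_wasserstein1 {m₁ m₂ : Measure ℝ} [IsProbabilityMeasure m₁]
    [IsProbabilityMeasure m₂] (h₁ : Integrable (fun x => x) m₁)
    (h₂ : Integrable (fun x => x) m₂) :
    |∫ x, x ∂m₁ - ∫ x, x ∂m₂| ≤ wasserstein1 m₁ m₂ := by
  rw [wasserstein1_eq, ← integral_quantile m₁ (fun x => x) h₁.1,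
    ← integral_quantile m₂ (fun x => x) h₂.1,
    ← integral_sub (integrable_quantile h₁) (integrable_quantile h₂)]
  exact abs_integral_le_integral_abs

theorem quantile_dirac (c : ℝ) {u : ℝ} (hu0 : 0 < u) (hu1 : u < 1) :
    quantile (Measure.dirac c) u = c := by
  have h : ∀ x, quantile (Measure.dirac c) u ≤ x ↔ c ≤ x := by
    intro x
    rw [quantile_le_iff hu0 hu1, cdf_eq_real, measureReal_def,
      Measure.dirac_apply' _ measurableSet_Iic]
    by_cases hx : c ≤ x
    · simp [hx, hu1.le]
    · simp [hx, hu0]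
  exact le_antisymm ((h c).2 le_rfl) ((h _).1 le_rfl)

theorem wasserstein1_dirac (m : Measure ℝ) [IsProbabilityMeasure m] (c : ℝ) :
    wasserstein1 m (Measure.dirac c) = ∫ x, |x - c| ∂m := by
  rw [wasserstein1_eq, ← integral_quantile m (fun x => |x - c|)
    (by fun_prop : Continuous fun x : ℝ => |x - c|).aestronglyMeasurable]
  exact setIntegral_congr_fun measurableSet_Ioo fun u hu => by
    simp only [quantile_dirac c hu.1 hu.2]

/-! ### Laws of bounded random variables -/

theorem IsConvexLaw.integrable {m : Measure ℝ} (hm : IsConvexLaw m) :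
    Integrable (fun x => x) m := by
  have := hm.isProb
  obtain ⟨C, hC⟩ := hm.bounded
  exact .of_bound aestronglyMeasurable_id C hC

theorem isConvexLaw_dirac (c : ℝ) : IsConvexLaw (Measure.dirac c) where
  isProb := inferInstance
  bounded := ⟨|c|, by rw [ae_dirac_eq]; exact (le_rfl : |c| ≤ |c|)⟩
  convex := by
    refine Set.Subsingleton.convex (Set.subsingleton_of_subset_singleton (a := c) ?_)
    refine Measure.support_subset_of_isClosed isClosed_singleton ?_
    rw [ae_dirac_eq]
    exact rfl

theorem BoundedRV.ConvexSupport.isConvexLaw {M : AmbiguityMDP} {X : BoundedRV M}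
    (hX : X.ConvexSupport) : IsConvexLaw X.dist where
  isProb := Measure.isProbabilityMeasure_map X.2.1.aemeasurable
  bounded := by
    obtain ⟨C, hC⟩ := X.2.2
    exact ⟨C, (ae_map_iff X.2.1.aemeasurable
      (measurableSet_le measurable_id.abs measurable_const)).2 hC⟩
  convex := hX

theorem BoundedRV.expectation_eq {M : AmbiguityMDP} (X : BoundedRV M) :
    X.expectation = ∫ x, x ∂X.dist :=
  (integral_map X.2.1.aemeasurable aestronglyMeasurable_id).symm

/-! ### The expectation is law-invariant, non-constant and continuous -/

section Expectation

variable {ρ : RiskMeasure}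

theorem RiskMeasure.IsExpectation.lawInvariant (hρ : ρ.IsExpectation) : ρ.LawInvariant := by
  intro M M' X X' hX hX' h
  rw [hρ M X hX, hρ M' X' hX', X.expectation_eq, X'.expectation_eq, h]

theorem RiskMeasure.IsExpectation.w1Continuous (hρ : ρ.IsExpectation) : ρ.W1Continuous := by
  intro M X N Y hX hY hlim
  rw [tendsto_iff_dist_tendsto_zero]
  refine squeeze_zero (fun _ => dist_nonneg) (fun n => ?_) hlim
  rw [hρ M X hX, hρ _ _ (hY n), X.expectation_eq, (Y n).expectation_eq, Real.dist_eq]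
  have := (hY n).isConvexLaw.isProb
  have := hX.isConvexLaw.isProb
  exact abs_integral_sub_le_wasserstein1 (hY n).isConvexLaw.integrable hX.isConvexLaw.integrable

/-- An ambiguity-averse MDP with a single state and a single action. -/
def trivialMDP : AmbiguityMDP where
  data :=
    { S := Unit, A := Unit, r := 0, γ := 0, γ_nonneg := le_rfl, γ_lt_one := one_pos
      μ := stdSimplex.vertex () }
  law := Measure.dirac fun _ _ _ => stdSimplex.vertex ()

/-- The constant random variables. -/
def BoundedRV.const (M : AmbiguityMDP) (c : ℝ) : BoundedRV M :=
  ⟨fun _ => c, measurable_const, |c|, Eventually.of_forall fun _ => le_rfl⟩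

theorem BoundedRV.dist_const (M : AmbiguityMDP) (c : ℝ) :
    (BoundedRV.const M c).dist = Measure.dirac c := by
  change M.law.map (fun _ => c) = _
  rw [Measure.map_const, measure_univ, one_smul]

theorem RiskMeasure.IsExpectation.nonConstant (hρ : ρ.IsExpectation) : ρ.NonConstant := by
  have h : ∀ c, (BoundedRV.const trivialMDP c).ConvexSupport := fun c => by
    rw [BoundedRV.ConvexSupport, BoundedRV.dist_const]
    exact (isConvexLaw_dirac c).convex
  refine ⟨_, _, BoundedRV.const trivialMDP 0, BoundedRV.const trivialMDP 1, h 0, h 1, ?_⟩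
  rw [hρ _ _ (h 0), hρ _ _ (h 1), BoundedRV.expectation_eq, BoundedRV.expectation_eq,
    BoundedRV.dist_const, BoundedRV.dist_const]
  simp

/-! ### The expectation satisfies the Bellman equations for resampled kernels -/

section MeanKernel

variable {S A : Type} [Fintype S]

theorem measurable_kernel_apply (s : S) (a : A) (s' : S) :
    Measurable fun K : TransKernel S A => K s a s' := by
  have h : Measurable fun K : TransKernel S A => K s a := by fun_prop
  exact ((measurable_pi_apply s').comp measurable_subtype_coe).comp h

theorem kernel_apply_le_one (K : TransKernel S A) (s : S) (a : A) (s' : S) : K s a s' ≤ 1 := by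
  rw [← simplex_sum (K s a)]
  exact Finset.single_le_sum (fun x _ => simplex_nonneg (K s a) x) (Finset.mem_univ s')

theorem integrable_kernel_apply (ν : Measure (TransKernel S A)) [IsProbabilityMeasure ν]
    (s : S) (a : A) (s' : S) : Integrable (fun K : TransKernel S A => K s a s') ν := by
  refine .of_bound (measurable_kernel_apply s a s').aestronglyMeasurable 1
    (Eventually.of_forall fun K => ?_)
  rw [Real.norm_of_nonneg (simplex_nonneg _ _)]
  exact kernel_apply_le_one K s a s'

/-- The mean of a random transition kernel. -/
def meanKernel (ν : Measure (TransKernel S A)) [IsProbabilityMeasure ν] : TransKernel S A :=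
  fun s a => ⟨fun s' => ∫ K, K s a s' ∂ν, fun s' => integral_nonneg fun K => simplex_nonneg _ _, by
    rw [← integral_finsetSum _ fun s' _ => integrable_kernel_apply ν s a s']
    simp⟩

theorem meanKernel_apply (ν : Measure (TransKernel S A)) [IsProbabilityMeasure ν] (s : S) (a : A)
    (s' : S) : meanKernel ν s a s' = ∫ K, K s a s' ∂ν := rfl

variable [Fintype A]

theorem integral_nominalBellman (ν : Measure (TransKernel S A)) [IsProbabilityMeasure ν]
    (γ : ℝ) (r : S → A → S → ℝ) (π : StationaryPolicy S A) (v : S → ℝ) (s : S) :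
    ∫ K, nominalBellman γ r π K v s ∂ν = nominalBellman γ r π (meanKernel ν) v s := by
  have hi : ∀ a s', Integrable (fun K : TransKernel S A => K s a s' * (r s a s' + γ * v s')) ν :=
    fun a s' => (integrable_kernel_apply ν s a s').mul_const _
  simp only [nominalBellman]
  rw [integral_finsetSum _ fun a _ => (integrable_finsetSum _ fun s' _ => hi a s').const_mul _]
  refine Finset.sum_congr rfl fun a _ => ?_
  rw [integral_const_mul, integral_finsetSum _ fun s' _ => hi a s']
  congr 1
  refine Finset.sum_congr rfl fun s' _ => ?_
  rw [integral_mul_const, meanKernel_apply]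

variable [MeasurableSpace S] [DiscreteMeasurableSpace S] [MeasurableSpace A]
  [DiscreteMeasurableSpace A]

/-- The mean of the nominal value function under i.i.d. kernels. -/
def meanValue (ν : Measure (TransKernel S A)) [IsProbabilityMeasure ν] (γ : ℝ)
    (r : S → A → S → ℝ) (π : HistoryPolicy S A) (s : S) : ℝ :=
  ∫ P, nominalValue γ r π P s ∂(Measure.infinitePi fun _ : ℕ => ν)

theorem integrable_nominalValue {γ : ℝ} (h0 : 0 ≤ γ) (h1 : γ < 1) (r : S → A → S → ℝ)
    (π : HistoryPolicy S A) (s : S) (μ : Measure (ℕ → TransKernel S A)) [IsFiniteMeasure μ] :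
    Integrable (fun P => nominalValue γ r π P s) μ :=
  .of_bound (measurable_nominalValue γ r π s).aestronglyMeasurable _
    (Eventually.of_forall fun P => abs_nominalValue_le h0 h1 r π P s)

theorem abs_meanValue_le (ν : Measure (TransKernel S A)) [IsProbabilityMeasure ν] {γ : ℝ}
    (h0 : 0 ≤ γ) (h1 : γ < 1) (r : S → A → S → ℝ) (π : HistoryPolicy S A) (s : S) :
    |meanValue ν γ r π s| ≤ (1 - γ)⁻¹ * rewardBound r := by
  have h := norm_integral_le_of_norm_le_const (μ := Measure.infinitePi fun _ : ℕ => ν)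
    (f := fun P => nominalValue γ r π P s) (C := (1 - γ)⁻¹ * rewardBound r)
    (Eventually.of_forall fun P => abs_nominalValue_le h0 h1 r π P s)
  simpa [meanValue] using h

/-- In the one-step recursion each term is a product of a function of the first kernel and a
function of the later kernels. These are independent when kernels are resampled, so the expectation
factors and only the mean kernel remains. -/
theorem meanValue_eq (ν : Measure (TransKernel S A)) [IsProbabilityMeasure ν] {γ : ℝ}
    (h0 : 0 ≤ γ) (h1 : γ < 1) (r : S → A → S → ℝ) (π : HistoryPolicy S A) (s : S) :
    meanValue ν γ r π s = ∑ a, π 0 Fin.elim0 s a * ∑ s', meanKernel ν s a s' *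
      (r s a s' + γ * meanValue ν γ r (π.after (s, a)) s') := by
  set μ := Measure.infinitePi fun _ : ℕ => ν with hμ
  let c : TransKernel S A × (ℕ → TransKernel S A) → ℕ → TransKernel S A :=
    fun z n => Nat.casesOn n z.1 z.2
  have hc : Measurable c := by
    refine measurable_pi_lambda _ fun n => ?_
    cases n with
    | zero => exact measurable_fst
    | succ n => exact (measurable_pi_apply n).comp measurable_snd
  have hmap : (ν.prod μ).map c = μ := infinitePi_nat_map_cons ν
  have hV : ∀ a s', Integrable (fun P => r s a s' + γ * nominalValue γ r (π.after (s, a)) P s') μ :=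
    fun a s' => (integrable_const _).add ((integrable_nominalValue h0 h1 r _ s' μ).const_mul γ)
  have hi : ∀ a s', Integrable (fun z : TransKernel S A × (ℕ → TransKernel S A) =>
      z.1 s a s' * (r s a s' + γ * nominalValue γ r (π.after (s, a)) z.2 s')) (ν.prod μ) :=
    fun a s' => (integrable_kernel_apply ν s a s').mul_prod (hV a s')
  rw [meanValue, ← hμ, ← hmap, integral_map hc.aemeasurable
    (measurable_nominalValue γ r π s).aestronglyMeasurable]
  have hrec : ∀ z, nominalValue γ r π (c z) s = ∑ a, π 0 Fin.elim0 s a * ∑ s', z.1 s a s' *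
      (r s a s' + γ * nominalValue γ r (π.after (s, a)) z.2 s') :=
    fun z => nominalValue_eq h0 h1 r π (c z) s
  simp only [hrec]
  rw [integral_finsetSum _ fun a _ => (integrable_finsetSum _ fun s' _ => hi a s').const_mul _]
  refine Finset.sum_congr rfl fun a _ => ?_
  rw [integral_const_mul, integral_finsetSum _ fun s' _ => hi a s']
  congr 1
  refine Finset.sum_congr rfl fun s' _ => ?_
  rw [integral_prod_mul (fun K : TransKernel S A => K s a s')
      fun P => r s a s' + γ * nominalValue γ r (π.after (s, a)) P s', meanKernel_apply,
    integral_add (integrable_const _) ((integrable_nominalValue h0 h1 r _ s' μ).const_mul γ),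
    integral_const_mul]
  simp [meanValue, hμ]

end MeanKernel

/-! ### Bellman optimality for a fixed kernel -/

section Optimality

variable {S A : Type} [Fintype S] [Fintype A]

theorem sum_simplex_mul_le {X : Type} [Fintype X] (p : stdSimplex ℝ X) {f : X → ℝ} {R : ℝ}
    (hf : ∀ x, f x ≤ R) : ∑ x, p x * f x ≤ R :=
  calc ∑ x, p x * f x ≤ ∑ x, p x * R := Finset.sum_le_sum fun x _ =>
        mul_le_mul_of_nonneg_left (hf x) (simplex_nonneg p x)
    _ = R := by rw [← Finset.sum_mul, simplex_sum, one_mul]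

/-- A stationary policy is greedy with respect to `v` if it maximizes the Bellman operator. -/
theorem exists_greedy [Nonempty A] (γ : ℝ) (r : S → A → S → ℝ) (P : TransKernel S A)
    (v : S → ℝ) : ∃ d : StationaryPolicy S A, ∀ (d' : StationaryPolicy S A) (s : S),
      nominalBellman γ r d' P v s ≤ nominalBellman γ r d P v s := by
  classical
  choose g hg using fun s => Finite.exists_max fun a => ∑ s', P s a s' * (r s a s' + γ * v s')
  refine ⟨fun s => stdSimplex.vertex (g s), fun d' s => ?_⟩
  refine (sum_simplex_mul_le (d' s) (hg s)).trans_eq ?_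
  rw [nominalBellman, Finset.sum_eq_single (g s)]
  · simp [stdSimplex.vertex]
  · intro a _ ha
    simp [stdSimplex.vertex, ha]
  · simp

theorem nominalBellman_mono {γ : ℝ} (h0 : 0 ≤ γ) (r : S → A → S → ℝ) (d : StationaryPolicy S A)
    (P : TransKernel S A) {v w : S → ℝ} {c : ℝ} (h : ∀ s, v s ≤ w s + c) (s : S) :
    nominalBellman γ r d P v s ≤ nominalBellman γ r d P w s + γ * c := by
  have : nominalBellman γ r d P v s - nominalBellman γ r d P w s ≤ γ * c := by
    simp only [nominalBellman, ← Finset.sum_sub_distrib, ← mul_sub, add_sub_add_left_eq_sub]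
    refine sum_simplex_mul_le _ fun a => sum_simplex_mul_le _ fun s' => ?_
    exact mul_le_mul_of_nonneg_left (by linarith [h s']) h0
  linarith

/-- The recursion bounds the supremum V by its update under a greedy stationary policy `d`. The
value of `d` is a fixed point of that same update, and discounting forces the two to coincide. Only
the recursion for `U` is used, so the result applies to the mean values. -/
theorem iSup_eq_iSup_nominalBellman [Nonempty A] {γ : ℝ} (h0 : 0 ≤ γ) (h1 : γ < 1)
    (r : S → A → S → ℝ) (P : TransKernel S A) (U : HistoryPolicy S A → S → ℝ)
    (hU : ∀ π s, U π s = ∑ a, π 0 Fin.elim0 s a * ∑ s', P s a s' *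
      (r s a s' + γ * U (π.after (s, a)) s'))
    (hbdd : ∀ s, BddAbove (Set.range fun π => U π s)) :
    (fun s => ⨆ π, U π s) = fun s => ⨆ d, nominalBellman γ r d P (fun s => ⨆ π, U π s) s := by
  classical
  set V : S → ℝ := fun s => ⨆ π, U π s with hV
  obtain ⟨d, hd⟩ := exists_greedy γ r P V
  have hle : ∀ π s, U π s ≤ V s := fun π s => le_ciSup (hbdd s) π
  have hrec : ∀ s, U d.toHistory s = nominalBellman γ r d P (U d.toHistory) s :=
    fun s => hU d.toHistory s
  have hsub : ∀ s, V s ≤ nominalBellman γ r d P V s := by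
    intro s
    have : Nonempty (HistoryPolicy S A) := ⟨d.toHistory⟩
    refine ciSup_le fun π => ?_
    rw [hU]
    refine le_trans (Finset.sum_le_sum fun a _ => mul_le_mul_of_nonneg_left
      (Finset.sum_le_sum fun s' _ => mul_le_mul_of_nonneg_left ?_ (simplex_nonneg _ _))
        (simplex_nonneg _ _)) (hd (π 0 Fin.elim0) s)
    have := mul_le_mul_of_nonneg_left (hle (π.after (s, a)) s') h0
    linarith
  have heq : V = U d.toHistory := by
    funext s₀
    refine le_antisymm ?_ (hle _ s₀)
    have : Nonempty S := ⟨s₀⟩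
    -- At a state where the gap between V and the value of `d` is largest, the gap is at most γ
    -- times itself, hence nonpositive.
    obtain ⟨m, hm⟩ := Finite.exists_max fun s => V s - U d.toHistory s
    have h := nominalBellman_mono h0 r d P (v := V) (w := U d.toHistory)
      (c := V m - U d.toHistory m) (fun s => by linarith [hm s]) m
    rw [← hrec] at h
    have h' := hsub m
    have : V m - U d.toHistory m ≤ 0 := by
      by_contra! hpos
      nlinarith
    linarith [hm s₀]
  funext s
  have hmax : IsGreatest (Set.range fun d' : StationaryPolicy S A => nominalBellman γ r d' P V s)
      (nominalBellman γ r d P V s) := ⟨⟨d, rfl⟩, by rintro _ ⟨d', rfl⟩; exact hd d' s⟩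
  rw [iSup, hmax.csSup_eq, heq]
  exact hrec s

end Optimality

theorem RiskMeasure.IsExpectation.value_eq (hρ : ρ.IsExpectation) (D : MDPData)
    {ν : Measure (TransKernel D.S D.A)} [IsProbabilityMeasure ν] (h : HasConvexSupport ν)
    (π : HistoryPolicy D.S D.A) (s : D.S) :
    (D.withKernels .resampled ν).value ρ π s = meanValue ν D.γ D.r π s :=
  hρ _ _ (convexSupport_valueRV D .resampled h π s)

theorem RiskMeasure.IsExpectation.bellman_eq (hρ : ρ.IsExpectation) (D : MDPData) (k : KernelModel)
    {ν : Measure (TransKernel D.S D.A)} [IsProbabilityMeasure ν] (h : HasConvexSupport ν)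
    (π : StationaryPolicy D.S D.A) (v : D.S → ℝ) (s : D.S) :
    (D.withKernels k ν).bellman ρ π v s = nominalBellman D.γ D.r π (meanKernel ν) v s := by
  rw [← integral_nominalBellman]
  have hmap := integral_map (μ := k.pathLaw ν) (φ := fun P : ℕ → TransKernel D.S D.A => P 0)
    (measurable_pi_apply 0).aemeasurable
    (measurable_nominalBellman D.γ D.r π v s).aestronglyMeasurable
  rw [k.map_eval_pathLaw ν 0] at hmap
  exact (hρ _ _ (convexSupport_bellmanRV D k h π v s)).trans hmap.symm

theorem RiskMeasure.IsExpectation.policyEvaluation (hρ : ρ.IsExpectation) :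
    ρ.PolicyEvaluation .resampled := by
  intro D ν _ hν _ π
  funext s
  refine Eq.trans ?_ (hρ.bellman_eq D .resampled hν π _ s).symm
  have hval : (D.withKernels .resampled ν).value ρ π.toHistory = meanValue ν D.γ D.r π.toHistory :=
    funext fun s => hρ.value_eq D hν π.toHistory s
  rw [hval]
  exact meanValue_eq ν D.γ_nonneg D.γ_lt_one D.r π.toHistory s

theorem RiskMeasure.IsExpectation.policyOptimization (hρ : ρ.IsExpectation) :
    ρ.PolicyOptimization .resampled := by
  intro D ν _ hν _
  have hbdd : ∀ s : D.S, BddAbove (Set.range fun π : HistoryPolicy D.S D.A =>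
      meanValue ν D.γ D.r π s) := fun s => by
    refine ⟨(1 - D.γ)⁻¹ * rewardBound D.r, ?_⟩
    rintro _ ⟨π, rfl⟩
    exact (le_abs_self _).trans (abs_meanValue_le ν D.γ_nonneg D.γ_lt_one D.r π s)
  have hopt : (D.withKernels .resampled ν).optValue ρ = fun s => ⨆ π, meanValue ν D.γ D.r π s :=
    funext fun s => iSup_congr fun π => hρ.value_eq D hν π s
  refine ⟨fun s => ?_, fun s => ?_, ?_⟩
  · simpa only [hρ.value_eq D hν] using hbdd s
  · obtain ⟨d, hd⟩ := exists_greedy D.γ D.r (meanKernel ν) ((D.withKernels .resampled ν).optValue ρ)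
    refine ⟨nominalBellman D.γ D.r d (meanKernel ν) ((D.withKernels .resampled ν).optValue ρ) s, ?_⟩
    rintro _ ⟨d', rfl⟩
    exact (hρ.bellman_eq D .resampled hν d' _ s).trans_le (hd d' s)
  · rw [hopt]
    refine (iSup_eq_iSup_nominalBellman D.γ_nonneg D.γ_lt_one D.r (meanKernel ν) _
      (meanValue_eq ν D.γ_nonneg D.γ_lt_one D.r) hbdd).trans (funext fun s => ?_)
    exact iSup_congr fun d => (hρ.bellman_eq D .resampled hν d _ s).symm

end Expectation

/-! ### Instances in which every state has a single action and two successors -/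

section Split

/-- The kernel `K` moves from every state `s` to `τ₀ s` or `τ₁ s`. -/
def IsSplit {S A : Type} [Fintype S] (τ₀ τ₁ : S → S) (K : TransKernel S A) : Prop :=
  ∀ s a s', s' ≠ τ₀ s → s' ≠ τ₁ s → K s a s' = 0

/-- Subtracting the constant f(τ₀ s) leaves only the term at τ₁ s, so the formula also covers
coinciding successors. -/
theorem IsSplit.sum_mul {S A : Type} [Fintype S] {τ₀ τ₁ : S → S} {K : TransKernel S A}
    (hK : IsSplit τ₀ τ₁ K) (s : S) (a : A) (f : S → ℝ) :
    ∑ s', K s a s' * f s' =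
      (1 - K s a (τ₁ s)) * f (τ₀ s) + K s a (τ₁ s) * f (τ₁ s) := by
  classical
  have key : ∀ g : S → ℝ, g (τ₀ s) = 0 → ∑ s', K s a s' * g s' = K s a (τ₁ s) * g (τ₁ s) := by
    intro g hg
    refine Finset.sum_eq_single _ (fun s' _ hs' => ?_) (by simp)
    by_cases h : s' = τ₀ s
    · rw [h, hg, mul_zero]
    · rw [hK s a s' h hs', zero_mul]
  have h := key (fun s' => f s' - f (τ₀ s)) (sub_self _)
  simp only [mul_sub, Finset.sum_sub_distrib, ← Finset.sum_mul, simplex_sum] at h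
  linarith

/-! ### Nominal values with one action and two successors -/

section NominalValue

variable {S A : Type} [Fintype S] [Fintype A] [Subsingleton A] {τ₀ τ₁ : S → S}

theorem simplex_apply_of_subsingleton (p : stdSimplex ℝ A) (a : A) : p a = 1 := by
  rw [← simplex_sum p, Fintype.sum_subsingleton _ a]

instance : Subsingleton (stdSimplex ℝ A) :=
  ⟨fun p q => Subtype.ext (funext fun a =>
    (simplex_apply_of_subsingleton p a).trans (simplex_apply_of_subsingleton q a).symm)⟩

theorem nominalBellman_split (γ : ℝ) (r : S → A → S → ℝ) (π : StationaryPolicy S A)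
    {K : TransKernel S A} (hK : IsSplit τ₀ τ₁ K) (v : S → ℝ) (s : S) (a : A) :
    nominalBellman γ r π K v s = (1 - K s a (τ₁ s)) * (r s a (τ₀ s) + γ * v (τ₀ s)) +
      K s a (τ₁ s) * (r s a (τ₁ s) + γ * v (τ₁ s)) := by
  rw [nominalBellman, Fintype.sum_subsingleton _ a, simplex_apply_of_subsingleton, one_mul,
    hK.sum_mul]

variable [MeasurableSpace S] [DiscreteMeasurableSpace S] [MeasurableSpace A]
  [DiscreteMeasurableSpace A]

theorem nominalValue_split {γ : ℝ} (h0 : 0 ≤ γ) (h1 : γ < 1) (r : S → A → S → ℝ)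
    (π : HistoryPolicy S A) {P : ℕ → TransKernel S A} (hP : IsSplit τ₀ τ₁ (P 0)) (s : S) (a : A) :
    nominalValue γ r π P s =
      (1 - P 0 s a (τ₁ s)) *
        (r s a (τ₀ s) + γ * nominalValue γ r π (fun n => P (n + 1)) (τ₀ s)) +
      P 0 s a (τ₁ s) *
        (r s a (τ₁ s) + γ * nominalValue γ r π (fun n => P (n + 1)) (τ₁ s)) := by
  rw [nominalValue_eq h0 h1, Fintype.sum_subsingleton _ a, simplex_apply_of_subsingleton, one_mul,
    hP.sum_mul, Subsingleton.elim (π.after (s, a)) π]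

/-- With zero reward the value is γ times the value for the shifted kernels. The bound on values is
uniform in the kernels, so iterating sends it to zero even when the kernels vary in time. -/
theorem nominalValue_absorbing {γ : ℝ} (h0 : 0 ≤ γ) (h1 : γ < 1) (r : S → A → S → ℝ)
    (π : HistoryPolicy S A) {P : ℕ → TransKernel S A} (hP : ∀ n, IsSplit τ₀ τ₁ (P n)) {s : S}
    (hs₀ : τ₀ s = s) (hs₁ : τ₁ s = s) (hr : ∀ a, r s a s = 0) (a : A) :
    nominalValue γ r π P s = 0 := by
  have hstep : ∀ P : ℕ → TransKernel S A, IsSplit τ₀ τ₁ (P 0) →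
      nominalValue γ r π P s = γ * nominalValue γ r π (fun n => P (n + 1)) s := by
    intro P hP
    rw [nominalValue_split h0 h1 r π hP s a, hs₀, hs₁, hr]
    ring
  have hn : ∀ n, |nominalValue γ r π P s| ≤ γ ^ n * ((1 - γ)⁻¹ * rewardBound r) := by
    intro n
    induction n generalizing P with
    | zero => simpa using abs_nominalValue_le h0 h1 r π P s
    | succ n ih =>
      rw [hstep P (hP 0), abs_mul, abs_of_nonneg h0, pow_succ', mul_assoc]
      exact mul_le_mul_of_nonneg_left (ih fun k => hP (k + 1)) h0
  have hlim : Tendsto (fun n : ℕ => γ ^ n * ((1 - γ)⁻¹ * rewardBound r)) atTop (𝓝 0) := by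
    simpa using (tendsto_pow_atTop_nhds_zero_of_lt_one h0 h1).mul_const _
  exact abs_nonpos_iff.1 (ge_of_tendsto' hlim hn)

end NominalValue

/-! ### Random split kernels with independent rows -/

variable {S : Type} [Fintype S] [DecidableEq S]

/-- The distribution that puts mass `q` on `t₁` and mass `1 - q` on `t₀`. -/
def splitRow (t₀ t₁ : S) (q : ℝ) : Unit → stdSimplex ℝ S := fun _ =>
  -- Clamping `q` to the unit interval makes the row defined and continuous on all of ℝ; the laws
  -- used later live on the interval, where clamping has no effect.
  ⟨(1 - (Set.projIcc 0 1 zero_le_one q : ℝ)) • (Pi.single t₀ 1 : S → ℝ) +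
      (Set.projIcc 0 1 zero_le_one q : ℝ) • (Pi.single t₁ 1 : S → ℝ),
    (convex_stdSimplex ℝ S) (single_mem_stdSimplex ℝ t₀) (single_mem_stdSimplex ℝ t₁)
      (sub_nonneg.2 (Set.projIcc 0 1 zero_le_one q).2.2) (Set.projIcc 0 1 zero_le_one q).2.1
      (sub_add_cancel _ _)⟩

theorem splitRow_apply (t₀ t₁ : S) {q : ℝ} (hq : q ∈ Set.Icc (0 : ℝ) 1) (a : Unit) (s' : S) :
    splitRow t₀ t₁ q a s' =
      (1 - q) * (Pi.single t₀ 1 : S → ℝ) s' + q * (Pi.single t₁ 1 : S → ℝ) s' := by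
  change (1 - (Set.projIcc 0 1 zero_le_one q : ℝ)) * (Pi.single t₀ 1 : S → ℝ) s' +
      (Set.projIcc 0 1 zero_le_one q : ℝ) * (Pi.single t₁ 1 : S → ℝ) s' = _
  rw [Set.projIcc_of_mem zero_le_one hq]

theorem measurable_splitRow (t₀ t₁ : S) : Measurable (splitRow t₀ t₁) := by
  refine Continuous.measurable (continuous_pi fun _ => Continuous.subtype_mk ?_ _)
  have h : Continuous fun q : ℝ => (Set.projIcc 0 1 zero_le_one q : ℝ) :=
    continuous_subtype_val.comp continuous_projIcc
  fun_prop

/-- The kernel that moves from `s` to `τ₁ s` with probability `q s` and to `τ₀ s` otherwise. -/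
def splitKernel (τ₀ τ₁ : S → S) (q : S → ℝ) : TransKernel S Unit :=
  fun s => splitRow (τ₀ s) (τ₁ s) (q s)

theorem measurable_splitKernel (τ₀ τ₁ : S → S) : Measurable (splitKernel τ₀ τ₁) :=
  measurable_pi_lambda _ fun s => (measurable_splitRow _ _).comp (measurable_pi_apply s)

theorem isSplit_splitKernel (τ₀ τ₁ : S → S) (q : S → ℝ) : IsSplit τ₀ τ₁ (splitKernel τ₀ τ₁ q) := by
  intro s a s' h0 h1
  change (1 - (Set.projIcc 0 1 zero_le_one (q s) : ℝ)) * (Pi.single (τ₀ s) 1 : S → ℝ) s' +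
      (Set.projIcc 0 1 zero_le_one (q s) : ℝ) * (Pi.single (τ₁ s) 1 : S → ℝ) s' = 0
  simp [h0, h1]

/-- The law of the kernel whose rows are split independently according to the laws `m s`. -/
def splitLaw (τ₀ τ₁ : S → S) (m : S → Measure ℝ) [∀ s, IsProbabilityMeasure (m s)] :
    Measure (TransKernel S Unit) :=
  (Measure.infinitePi m).map (splitKernel τ₀ τ₁)

variable (τ₀ τ₁ : S → S) (m : S → Measure ℝ) [∀ s, IsProbabilityMeasure (m s)]

instance : IsProbabilityMeasure (splitLaw τ₀ τ₁ m) :=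
  Measure.isProbabilityMeasure_map (measurable_splitKernel τ₀ τ₁).aemeasurable

theorem hasProductStructure_splitLaw : HasProductStructure (splitLaw τ₀ τ₁ m) := by
  have hprob : ∀ s, IsProbabilityMeasure ((m s).map (splitRow (τ₀ s) (τ₁ s))) := fun s =>
    Measure.isProbabilityMeasure_map (measurable_splitRow _ _).aemeasurable
  have h : splitLaw τ₀ τ₁ m =
      Measure.infinitePi fun s => (m s).map (splitRow (τ₀ s) (τ₁ s)) :=
    Measure.infinitePi_map_pi m fun s => measurable_splitRow (τ₀ s) (τ₁ s)
  rw [HasProductStructure, h]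
  exact iIndepFun_infinitePi (X := fun _ ω => ω) fun _ => measurable_id

/-- Off a null set the clamping disappears and the kernel is an affine function `H` of the
probabilities. The support of their product law is a product of convex sets, and its affine image
and the closure of that image are convex. -/
theorem hasConvexSupport_splitLaw (hm : ∀ s, ∀ᵐ q ∂(m s), q ∈ Set.Icc (0 : ℝ) 1)
    (hc : ∀ s, Convex ℝ (m s).support) : HasConvexSupport (splitLaw τ₀ τ₁ m) := by
  let H : (S → ℝ) → S → Unit → S → ℝ := fun q s _ s' =>
    (1 - q s) * (Pi.single (τ₀ s) 1 : S → ℝ) s' + q s * (Pi.single (τ₁ s) 1 : S → ℝ) s'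
  have hH : Continuous H := by fun_prop
  have hae : (fun q => (splitKernel τ₀ τ₁ q).toFun) =ᵐ[Measure.infinitePi m] H := by
    have hall : ∀ᵐ q ∂(Measure.infinitePi m), ∀ s, q s ∈ Set.Icc (0 : ℝ) 1 := by
      rw [ae_all_iff]
      intro s
      exact (measurePreserving_eval_infinitePi m s).quasiMeasurePreserving.ae (hm s)
    filter_upwards [hall] with q hq
    funext s a s'
    exact splitRow_apply _ _ (hq s) a s'
  have hmap : (splitLaw τ₀ τ₁ m).map TransKernel.toFun = (Measure.infinitePi m).map H := by
    rw [splitLaw, Measure.map_map TransKernel.continuous_toFun.measurable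
      (measurable_splitKernel τ₀ τ₁)]
    exact Measure.map_congr hae
  change Convex ℝ ((splitLaw τ₀ τ₁ m).map TransKernel.toFun).support
  rw [hmap, support_map_eq_closure_image _ hH, support_infinitePi]
  refine Convex.closure ?_
  rintro _ ⟨x, hx, rfl⟩ _ ⟨y, hy, rfl⟩ a b ha hb hab
  refine ⟨a • x + b • y, (convex_pi fun s _ => hc s) hx hy ha hb hab, ?_⟩
  funext s u s'
  obtain rfl : b = 1 - a := by linarith
  simp only [H, Pi.add_apply, Pi.smul_apply, smul_eq_mul]
  ring

omit [DecidableEq S] in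
theorem measurableSet_isSplit : MeasurableSet {K : TransKernel S Unit | IsSplit τ₀ τ₁ K} := by
  classical
  have : {K : TransKernel S Unit | IsSplit τ₀ τ₁ K} = ⋂ (s) (a) (s'),
      {K : TransKernel S Unit | s' ≠ τ₀ s → s' ≠ τ₁ s → K s a s' = 0} := by
    ext K
    simp [IsSplit]
  rw [this]
  refine .iInter fun s => .iInter fun a => .iInter fun s' => ?_
  by_cases h0 : s' = τ₀ s
  · simp [h0]
  by_cases h1 : s' = τ₁ s
  · simp [h1]
  simp only [ne_eq, h0, h1, not_false_eq_true, true_imp_iff]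
  exact measurable_kernel_apply s a s' (measurableSet_singleton 0)

theorem ae_isSplit : ∀ᵐ K ∂(splitLaw τ₀ τ₁ m), IsSplit τ₀ τ₁ K :=
  (ae_map_iff (measurable_splitKernel τ₀ τ₁).aemeasurable (measurableSet_isSplit τ₀ τ₁)).2
    (Eventually.of_forall (isSplit_splitKernel τ₀ τ₁))

theorem ae_pathLaw_isSplit (k : KernelModel) :
    ∀ᵐ P ∂(k.pathLaw (splitLaw τ₀ τ₁ m)), ∀ n, IsSplit τ₀ τ₁ (P n) := by
  rw [ae_all_iff]
  intro n
  refine ae_of_ae_map (f := fun P : ℕ → TransKernel S Unit => P n)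
    (measurable_pi_apply n).aemeasurable ?_
  rw [k.map_eval_pathLaw]
  exact ae_isSplit τ₀ τ₁ m

theorem map_pathLaw_apply (k : KernelModel) (n : ℕ)
    (hm : ∀ s, ∀ᵐ q ∂(m s), q ∈ Set.Icc (0 : ℝ) 1) {s : S} (hs : τ₀ s ≠ τ₁ s) (a : Unit) :
    (k.pathLaw (splitLaw τ₀ τ₁ m)).map (fun P => P n s a (τ₁ s)) = m s := by
  have h1 : Measurable fun K : TransKernel S Unit => K s a (τ₁ s) := measurable_kernel_apply s a _
  have h2 := Measure.map_map (μ := k.pathLaw (splitLaw τ₀ τ₁ m)) h1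
    (measurable_pi_apply (X := fun _ => TransKernel S Unit) n)
  rw [k.map_eval_pathLaw] at h2
  refine h2.symm.trans ?_
  rw [splitLaw, Measure.map_map h1 (measurable_splitKernel τ₀ τ₁)]
  conv_rhs => rw [← Measure.infinitePi_map_eval m s]
  refine Measure.map_congr ?_
  filter_upwards [(measurePreserving_eval_infinitePi m s).quasiMeasurePreserving.ae (hm s)]
    with q hq
  refine (splitRow_apply _ _ hq a _).trans ?_
  simp [hs.symm]

/-- Two rows of the kernel at the same time are independent under both kernel models, since each
kernel has law `splitLaw`. This is why one instance serves both. -/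
theorem map_pathLaw_apply_prod (k : KernelModel) (n : ℕ)
    (hm : ∀ s, ∀ᵐ q ∂(m s), q ∈ Set.Icc (0 : ℝ) 1) {s s' : S} (hs : τ₀ s ≠ τ₁ s)
    (hs' : τ₀ s' ≠ τ₁ s') (hss' : s ≠ s') (a : Unit) :
    (k.pathLaw (splitLaw τ₀ τ₁ m)).map (fun P => (P n s a (τ₁ s), P n s' a (τ₁ s'))) =
      (m s).prod (m s') := by
  have h1 : Measurable fun K : TransKernel S Unit => (K s a (τ₁ s), K s' a (τ₁ s')) :=
    (measurable_kernel_apply s a _).prodMk (measurable_kernel_apply s' a _)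
  have h2 := Measure.map_map (μ := k.pathLaw (splitLaw τ₀ τ₁ m)) h1
    (measurable_pi_apply (X := fun _ => TransKernel S Unit) n)
  rw [k.map_eval_pathLaw] at h2
  refine h2.symm.trans ?_
  rw [splitLaw, Measure.map_map h1 (measurable_splitKernel τ₀ τ₁),
    ← Measure.infinitePi_map_eval_prod (P := m) hss']
  refine Measure.map_congr ?_
  filter_upwards [(measurePreserving_eval_infinitePi m s).quasiMeasurePreserving.ae (hm s),
    (measurePreserving_eval_infinitePi m s').quasiMeasurePreserving.ae (hm s')] with q hq hq'
  refine Prod.ext ((splitRow_apply _ _ hq a _).trans ?_) ((splitRow_apply _ _ hq' a _).trans ?_)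
  · simp [hs.symm]
  · simp [hs'.symm]

end Split

/-! ### Evaluation with a single action -/

/-- The Bellman equation for policy evaluation, for the instances with a single action. -/
def RiskMeasure.SingleActionEvaluation (ρ : RiskMeasure) (k : KernelModel) : Prop :=
  ∀ (D : MDPData) (ν : Measure (TransKernel D.S D.A)) [IsProbabilityMeasure ν],
    Subsingleton D.A → HasConvexSupport ν → HasProductStructure ν →
    ∀ π : StationaryPolicy D.S D.A,
      (D.withKernels k ν).value ρ π.toHistory =
        (D.withKernels k ν).bellman ρ π ((D.withKernels k ν).value ρ π.toHistory)

theorem RiskMeasure.PolicyEvaluation.singleAction {ρ : RiskMeasure} {k : KernelModel}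
    (h : ρ.PolicyEvaluation k) : ρ.SingleActionEvaluation k :=
  fun D ν _ _ hν hν' => h D ν hν hν'

/-- With one action there is exactly one policy of each kind, so both suprema are over singletons.
-/
theorem RiskMeasure.PolicyOptimization.singleAction {ρ : RiskMeasure} {k : KernelModel}
    (h : ρ.PolicyOptimization k) : ρ.SingleActionEvaluation k := by
  intro D ν _ hA hν hν' π
  have hval : (D.withKernels k ν).optValue ρ = (D.withKernels k ν).value ρ π.toHistory :=
    funext fun s => ciSup_subsingleton (ι := HistoryPolicy D.S D.A) π.toHistory _
  have hbell : ∀ v, (D.withKernels k ν).optBellman ρ v = (D.withKernels k ν).bellman ρ π v :=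
    fun v => funext fun s => ciSup_subsingleton (ι := StationaryPolicy D.S D.A) π _
  have := (h D ν hν hν').2.2
  rwa [hval, hbell] at this

/-- The MDP with a single action, rewards `r` and discount factor `γ`. -/
def singleActionMDP {S : Type} [Fintype S] [DecidableEq S] (s₀ : S) (r : S → S → ℝ) {γ : ℝ}
    (h0 : 0 ≤ γ) (h1 : γ < 1) : MDPData where
  S := S
  A := Unit
  r := fun s _ s' => r s s'
  γ := γ
  γ_nonneg := h0
  γ_lt_one := h1
  μ := stdSimplex.vertex s₀

/-! ### An instance that averages two independent values -/

/-- A continuous image of an interval is an interval, and continuity preserves boundedness on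
compact intervals. -/
theorem IsConvexLaw.map {m : Measure ℝ} (hm : IsConvexLaw m) {f : ℝ → ℝ} (hf : Continuous f) :
    IsConvexLaw (m.map f) where
  isProb := by
    have := hm.isProb
    exact Measure.isProbabilityMeasure_map hf.measurable.aemeasurable
  bounded := by
    obtain ⟨C, hC⟩ := hm.bounded
    obtain ⟨B, hB⟩ := (isCompact_Icc (a := -C) (b := C)).exists_bound_of_continuousOn
      hf.continuousOn
    refine ⟨B, (ae_map_iff hf.measurable.aemeasurable
      (measurableSet_le measurable_id.abs measurable_const)).2 ?_⟩
    filter_upwards [hC] with x hx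
    exact hB x (abs_le.1 hx)
  convex := by
    rw [support_map_eq_closure_image _ hf]
    exact Real.convex_iff_isPreconnected.2
      (hm.convex.isPreconnected.image _ hf.continuousOn).closure

/-- The first successors in the averaging instance. -/
def averageLeft : Fin 5 → Fin 5 := ![1, 3, 3, 3, 4]

/-- The second successors in the averaging instance. -/
def averageRight : Fin 5 → Fin 5 := ![2, 4, 4, 3, 4]

/-- The rewards of the averaging instance. -/
def averageReward (c C : ℝ) : Fin 5 → Fin 5 → ℝ :=
  ![fun _ => c, ![0, 0, 0, -C, C], ![0, 0, 0, -C, C], fun _ => 0, fun _ => 0]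

/-- The laws of the transition probabilities of the averaging instance. -/
def averageLaws (m₁ m₂ : Measure ℝ) : Fin 5 → Measure ℝ :=
  ![Measure.dirac (1 / 2), m₁, m₂, Measure.dirac 0, Measure.dirac 0]

/-! ### Nominal values in the averaging instance -/

section AverageValues

variable {γ : ℝ} (h0 : 0 ≤ γ) (h1 : γ < 1) (c C : ℝ)
  (π : HistoryPolicy (singleActionMDP (0 : Fin 5) (averageReward c C) h0 h1).S Unit)
  {P : ℕ → TransKernel (Fin 5) Unit}
  (hP : ∀ n, IsSplit averageLeft averageRight (P n))

include hP

theorem nominalValue_average_three :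
    nominalValue γ (singleActionMDP (0 : Fin 5) (averageReward c C) h0 h1).r π P (3 : Fin 5) = 0 :=
  nominalValue_absorbing h0 h1 _ π hP rfl rfl (fun _ => rfl) ()

theorem nominalValue_average_four :
    nominalValue γ (singleActionMDP (0 : Fin 5) (averageReward c C) h0 h1).r π P (4 : Fin 5) = 0 :=
  nominalValue_absorbing h0 h1 _ π hP rfl rfl (fun _ => rfl) ()

theorem nominalValue_average_one :
    nominalValue γ (singleActionMDP (0 : Fin 5) (averageReward c C) h0 h1).r π P (1 : Fin 5) =
      C * (2 * P 0 1 () 4 - 1) := by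
  refine (nominalValue_split h0 h1 _ π (hP 0) (1 : Fin 5) ()).trans ?_
  have h3 := nominalValue_average_three h0 h1 c C π fun n => hP (n + 1)
  have h4 := nominalValue_average_four h0 h1 c C π fun n => hP (n + 1)
  change (1 - P 0 1 () 4) * (-C + γ * nominalValue γ
      (singleActionMDP (0 : Fin 5) (averageReward c C) h0 h1).r π (fun n => P (n + 1)) (3 : Fin 5)) +
    P 0 1 () 4 * (C + γ * nominalValue γ
      (singleActionMDP (0 : Fin 5) (averageReward c C) h0 h1).r π (fun n => P (n + 1)) (4 : Fin 5)) = _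
  rw [h3, h4]
  ring

theorem nominalValue_average_two :
    nominalValue γ (singleActionMDP (0 : Fin 5) (averageReward c C) h0 h1).r π P (2 : Fin 5) =
      C * (2 * P 0 2 () 4 - 1) := by
  refine (nominalValue_split h0 h1 _ π (hP 0) (2 : Fin 5) ()).trans ?_
  have h3 := nominalValue_average_three h0 h1 c C π fun n => hP (n + 1)
  have h4 := nominalValue_average_four h0 h1 c C π fun n => hP (n + 1)
  change (1 - P 0 2 () 4) * (-C + γ * nominalValue γ
      (singleActionMDP (0 : Fin 5) (averageReward c C) h0 h1).r π (fun n => P (n + 1)) (3 : Fin 5)) +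
    P 0 2 () 4 * (C + γ * nominalValue γ
      (singleActionMDP (0 : Fin 5) (averageReward c C) h0 h1).r π (fun n => P (n + 1)) (4 : Fin 5)) = _
  rw [h3, h4]
  ring

theorem nominalValue_average_zero (hhalf : P 0 0 () 2 = 1 / 2) :
    nominalValue γ (singleActionMDP (0 : Fin 5) (averageReward c C) h0 h1).r π P (0 : Fin 5) =
      c + γ * ((C * (2 * P 1 1 () 4 - 1) + C * (2 * P 1 2 () 4 - 1)) / 2) := by
  refine (nominalValue_split h0 h1 _ π (hP 0) (0 : Fin 5) ()).trans ?_
  have h3 := nominalValue_average_one h0 h1 c C π fun n => hP (n + 1)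
  have h4 := nominalValue_average_two h0 h1 c C π fun n => hP (n + 1)
  change (1 - P 0 0 () 2) * (c + γ * nominalValue γ
      (singleActionMDP (0 : Fin 5) (averageReward c C) h0 h1).r π (fun n => P (n + 1)) (1 : Fin 5)) +
    P 0 0 () 2 * (c + γ * nominalValue γ
      (singleActionMDP (0 : Fin 5) (averageReward c C) h0 h1).r π (fun n => P (n + 1)) (2 : Fin 5)) = _
  rw [h3, h4, hhalf]
  ring

end AverageValues

/-- All ambiguity sits in states 1 and 2, and state 0 splits evenly between them. Its value averages
two independent variables of prescribed laws, while its one-step update is deterministic for every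
`v`. -/
theorem exists_averaging_instance (k : KernelModel) {γ : ℝ} (h0 : 0 ≤ γ) (h1 : γ < 1) (c : ℝ)
    {m₁ m₂ : Measure ℝ} (hm₁ : IsConvexLaw m₁) (hm₂ : IsConvexLaw m₂) :
    ∃ (D : MDPData) (ν : Measure (TransKernel D.S D.A)) (_ : IsProbabilityMeasure ν)
      (π : StationaryPolicy D.S D.A) (s₀ s₁ s₂ : D.S),
      Subsingleton D.A ∧ HasConvexSupport ν ∧ HasProductStructure ν ∧
      ((D.withKernels k ν).valueRV π.toHistory s₁).dist = m₁ ∧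
      ((D.withKernels k ν).valueRV π.toHistory s₂).dist = m₂ ∧
      ((D.withKernels k ν).valueRV π.toHistory s₀).dist =
        (m₁.prod m₂).map (fun y => c + γ * ((y.1 + y.2) / 2)) ∧
      ∀ v : D.S → ℝ, ((D.withKernels k ν).bellmanRV π v s₀).dist =
        Measure.dirac (c + γ * ((v s₁ + v s₂) / 2)) := by
  obtain ⟨C, hC, hC₁, hC₂⟩ : ∃ C : ℝ, 0 < C ∧ (∀ᵐ x ∂m₁, |x| ≤ C) ∧ ∀ᵐ x ∂m₂, |x| ≤ C := by
    obtain ⟨C₁, h₁⟩ := hm₁.bounded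
    obtain ⟨C₂, h₂⟩ := hm₂.bounded
    refine ⟨max 1 (max C₁ C₂), by positivity, ?_, ?_⟩
    · filter_upwards [h₁] with x hx
      exact hx.trans ((le_max_left _ _).trans (le_max_right _ _))
    · filter_upwards [h₂] with x hx
      exact hx.trans ((le_max_right _ _).trans (le_max_right _ _))
  -- `u` maps [-C, C] onto the unit interval and `w` is its inverse: a target value x becomes the
  -- probability of earning C rather than -C.
  let u : ℝ → ℝ := fun x => (x + C) / (2 * C)
  let w : ℝ → ℝ := fun q => C * (2 * q - 1)
  have hu : Continuous u := by fun_prop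
  have hw : Continuous w := by fun_prop
  have hwu : w ∘ u = id := by
    funext x
    simp only [w, u, Function.comp, id]
    field_simp
    ring
  have hback : ∀ m : Measure ℝ, (m.map u).map w = m := fun m => by
    rw [Measure.map_map hw.measurable hu.measurable, hwu, Measure.map_id]
  have hIcc : ∀ m : Measure ℝ, (∀ᵐ x ∂m, |x| ≤ C) → ∀ᵐ q ∂(m.map u), q ∈ Set.Icc (0 : ℝ) 1 := by
    intro m hm
    refine (ae_map_iff hu.measurable.aemeasurable measurableSet_Icc).2 ?_
    filter_upwards [hm] with x hx
    rw [abs_le] at hx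
    constructor
    · exact div_nonneg (by linarith [hx.1]) (by linarith)
    · rw [div_le_one (by linarith)]
      linarith [hx.2]
  let m := averageLaws (m₁.map u) (m₂.map u)
  have hdirac : ∀ x : ℝ, x ∈ Set.Icc (0 : ℝ) 1 → ∀ᵐ q ∂(Measure.dirac x), q ∈ Set.Icc (0 : ℝ) 1 :=
    fun x hx => by rw [ae_dirac_eq]; exact hx
  have hlaw : ∀ s, IsConvexLaw (m s) := by
    intro s
    fin_cases s
    exacts [isConvexLaw_dirac _, hm₁.map hu, hm₂.map hu, isConvexLaw_dirac _, isConvexLaw_dirac _]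
  have hmIcc : ∀ s, ∀ᵐ q ∂(m s), q ∈ Set.Icc (0 : ℝ) 1 := by
    intro s
    fin_cases s
    exacts [hdirac _ (by norm_num), hIcc _ hC₁, hIcc _ hC₂, hdirac _ (by norm_num),
      hdirac _ (by norm_num)]
  have hprob : ∀ s, IsProbabilityMeasure (m s) := fun s => (hlaw s).isProb
  let ν := splitLaw averageLeft averageRight m
  let D := singleActionMDP (0 : Fin 5) (averageReward c C) h0 h1
  have hae := ae_pathLaw_isSplit averageLeft averageRight m k
  let p : ℕ → Fin 5 → Fin 5 → (ℕ → TransKernel (Fin 5) Unit) → ℝ := fun n s s' P => P n s () s'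
  have hmeas : ∀ n s s', Measurable (p n s s') := fun n s s' =>
    (measurable_kernel_apply s () s').comp
      (measurable_pi_apply (X := fun _ => TransKernel (Fin 5) Unit) n)
  have hhalf : ∀ᵐ P ∂(k.pathLaw ν), P 0 (0 : Fin 5) () 2 = 1 / 2 := by
    have h := map_pathLaw_apply averageLeft averageRight m k 0 hmIcc (s := 0)
      (by simp [averageLeft, averageRight]) ()
    refine ae_of_ae_map (f := p 0 0 2) (p := fun q => q = 1 / 2) (hmeas 0 0 2).aemeasurable ?_
    have h' : (k.pathLaw ν).map (p 0 0 2) = Measure.dirac (1 / 2) := h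
    rw [h', ae_dirac_eq]
    exact (rfl : (1 / 2 : ℝ) = 1 / 2)
  let π : StationaryPolicy (Fin 5) Unit := fun _ => stdSimplex.vertex (() : Unit)
  refine ⟨D, ν, inferInstanceAs (IsProbabilityMeasure (splitLaw averageLeft averageRight m)), π,
    (0 : Fin 5), (1 : Fin 5), (2 : Fin 5), inferInstanceAs (Subsingleton Unit),
    hasConvexSupport_splitLaw _ _ m hmIcc fun s => (hlaw s).convex,
    hasProductStructure_splitLaw _ _ m, ?_, ?_, ?_, fun v => ?_⟩
  · have h := map_pathLaw_apply averageLeft averageRight m k 0 hmIcc (s := 1)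
      (by simp [averageLeft, averageRight]) ()
    refine Eq.trans (Measure.map_congr (g := w ∘ p 0 1 4) ?_) ?_
    · filter_upwards [hae] with P hP
      exact nominalValue_average_one h0 h1 c C π.toHistory hP
    · refine (Measure.map_map hw.measurable (hmeas 0 1 4)).symm.trans ?_
      exact (congrArg (Measure.map w) h).trans (hback m₁)
  · have h := map_pathLaw_apply averageLeft averageRight m k 0 hmIcc (s := 2)
      (by simp [averageLeft, averageRight]) ()
    refine Eq.trans (Measure.map_congr (g := w ∘ p 0 2 4) ?_) ?_
    · filter_upwards [hae] with P hP
      exact nominalValue_average_two h0 h1 c C π.toHistory hP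
    · refine (Measure.map_map hw.measurable (hmeas 0 2 4)).symm.trans ?_
      exact (congrArg (Measure.map w) h).trans (hback m₂)
  -- Started from state 0, the ambiguous rows are used at time 1, by both branches, hence the joint
  -- law at `n = 1`.
  · have h := map_pathLaw_apply_prod averageLeft averageRight m k 1 hmIcc (s := 1) (s' := 2)
      (by simp [averageLeft, averageRight]) (by simp [averageLeft, averageRight]) (by decide) ()
    let g : ℝ × ℝ → ℝ := fun y => c + γ * ((y.1 + y.2) / 2)
    have hg : Measurable g := by fun_prop
    refine Eq.trans (Measure.map_congr
      (g := (g ∘ Prod.map w w) ∘ fun P => (p 1 1 4 P, p 1 2 4 P)) ?_) ?_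
    · filter_upwards [hae, hhalf] with P hP hP'
      exact nominalValue_average_zero h0 h1 c C π.toHistory hP hP'
    · refine (Measure.map_map (hg.comp (hw.measurable.prodMap hw.measurable))
        ((hmeas 1 1 4).prodMk (hmeas 1 2 4))).symm.trans ?_
      refine (congrArg (Measure.map (g ∘ Prod.map w w)) h).trans ?_
      rw [← Measure.map_map hg (hw.measurable.prodMap hw.measurable)]
      have := hprob 1
      have := hprob 2
      have hp₁ := hm₁.isProb
      have hp₂ := hm₂.isProb
      rw [← Measure.map_prod_map _ _ hw.measurable hw.measurable]
      exact congrArg (Measure.map g) (congrArg₂ Measure.prod (hback m₁) (hback m₂))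
  · refine Eq.trans (Measure.map_congr (g := fun _ => c + γ *
      ((v (1 : Fin 5) + v (2 : Fin 5)) / 2)) ?_) ?_
    · filter_upwards [hae, hhalf] with P hP hP'
      refine (nominalBellman_split (S := Fin 5) (A := Unit) γ D.r π (hP 0) v 0 ()).trans ?_
      change (1 - p 0 0 2 P) * (c + γ * v (1 : Fin 5)) +
        p 0 0 2 P * (c + γ * v (2 : Fin 5)) = _
      rw [show p 0 0 2 P = 1 / 2 from hP']
      ring
    · rw [Measure.map_const, measure_univ, one_smul]

/-! ### The risk measure as a function of the law -/

/-- The averaging instance realizes any such law as the value at its state 1; the discount factor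
plays no role there. -/
theorem IsConvexLaw.exists_dist_eq {m : Measure ℝ} (hm : IsConvexLaw m) :
    ∃ (M : AmbiguityMDP) (X : BoundedRV M), X.ConvexSupport ∧ X.dist = m := by
  obtain ⟨D, ν, _, π, _, s₁, _, _, hν, _, h₁, _⟩ :=
    exists_averaging_instance .static (γ := 0) le_rfl one_pos 0 hm hm
  exact ⟨_, _, convexSupport_valueRV D .static hν π.toHistory s₁, h₁⟩

open Classical in
/-- The common value of a law-invariant risk measure on the random variables of law `m`. -/
def RiskMeasure.onLaw (ρ : RiskMeasure) (m : Measure ℝ) : ℝ :=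
  if h : ∃ (M : AmbiguityMDP) (X : BoundedRV M), X.ConvexSupport ∧ X.dist = m then
    -- The default 0 is never reached on convex laws, by `IsConvexLaw.exists_dist_eq`.
    ρ h.choose h.choose_spec.choose else 0

variable {ρ : RiskMeasure}

theorem RiskMeasure.LawInvariant.eq_onLaw (hρ : ρ.LawInvariant) {M : AmbiguityMDP}
    {X : BoundedRV M} (hX : X.ConvexSupport) : ρ M X = ρ.onLaw X.dist := by
  have h : ∃ (M' : AmbiguityMDP) (X' : BoundedRV M'), X'.ConvexSupport ∧ X'.dist = X.dist :=
    ⟨M, X, hX, rfl⟩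
  rw [RiskMeasure.onLaw, dif_pos h]
  exact hρ _ _ _ _ hX h.choose_spec.choose_spec.1 h.choose_spec.choose_spec.2.symm

/-- This is the Bellman equation at state 0 of the averaging instance, the functional equation from
which everything about ρ is derived. Convexity of the averaged law's support comes for free, as it
is the law of a value. -/
theorem RiskMeasure.SingleActionEvaluation.onLaw_average {k : KernelModel}
    (h : ρ.SingleActionEvaluation k) (hρ : ρ.LawInvariant) {γ : ℝ} (h0 : 0 ≤ γ) (h1 : γ < 1)
    (c : ℝ) {m₁ m₂ : Measure ℝ} (hm₁ : IsConvexLaw m₁) (hm₂ : IsConvexLaw m₂) :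
    IsConvexLaw ((m₁.prod m₂).map fun y => c + γ * ((y.1 + y.2) / 2)) ∧
    ρ.onLaw ((m₁.prod m₂).map fun y => c + γ * ((y.1 + y.2) / 2)) =
      ρ.onLaw (Measure.dirac (c + γ * ((ρ.onLaw m₁ + ρ.onLaw m₂) / 2))) := by
  obtain ⟨D, ν, _, π, s₀, s₁, s₂, hA, hν, hν', h₁, h₂, h₃, h₄⟩ :=
    exists_averaging_instance k h0 h1 c hm₁ hm₂
  have hval : ∀ s, (D.withKernels k ν).value ρ π.toHistory s =
      ρ.onLaw ((D.withKernels k ν).valueRV π.toHistory s).dist := fun s =>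
    hρ.eq_onLaw (convexSupport_valueRV D k hν π.toHistory s)
  have hbell := hρ.eq_onLaw
    (convexSupport_bellmanRV D k hν π ((D.withKernels k ν).value ρ π.toHistory) s₀)
  have heq := congrFun (h D ν hA hν hν' π) s₀
  refine ⟨h₃ ▸ (convexSupport_valueRV D k hν π.toHistory s₀).isConvexLaw, ?_⟩
  rw [← h₃]
  refine (hval s₀).symm.trans (heq.trans (hbell.trans ?_))
  refine congrArg ρ.onLaw ((h₄ _).trans ?_)
  have e₁ := hval s₁
  have e₂ := hval s₂
  rw [h₁] at e₁
  rw [h₂] at e₂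
  rw [← e₁, ← e₂]

theorem RiskMeasure.NonConstant.exists_onLaw_ne (hρ : ρ.LawInvariant) (hn : ρ.NonConstant) :
    ∃ m m' : Measure ℝ, IsConvexLaw m ∧ IsConvexLaw m' ∧ ρ.onLaw m ≠ ρ.onLaw m' := by
  obtain ⟨M, M', X, X', hX, hX', hne⟩ := hn
  refine ⟨X.dist, X'.dist, hX.isConvexLaw, hX'.isConvexLaw, ?_⟩
  rwa [← hρ.eq_onLaw hX, ← hρ.eq_onLaw hX']

theorem RiskMeasure.W1Continuous.tendsto_onLaw (hρ : ρ.LawInvariant) (hc : ρ.W1Continuous)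
    {m : ℕ → Measure ℝ} {m' : Measure ℝ} (hm : ∀ n, IsConvexLaw (m n)) (hm' : IsConvexLaw m')
    (hlim : Tendsto (fun n => wasserstein1 (m n) m') atTop (𝓝 0)) :
    Tendsto (fun n => ρ.onLaw (m n)) atTop (𝓝 (ρ.onLaw m')) := by
  choose N Y hY hYm using fun n => (hm n).exists_dist_eq
  obtain ⟨M, X, hX, rfl⟩ := hm'.exists_dist_eq
  have h := hc M X N Y hX hY (by simpa only [hYm] using hlim)
  simpa only [hρ.eq_onLaw hX, hρ.eq_onLaw (hY _), hYm] using h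

/-! ### Averaging a law with itself -/

/-- The law of the average of two independent variables of law `m`. -/
def selfAverage (m : Measure ℝ) : Measure ℝ := (m.prod m).map fun y => (y.1 + y.2) / 2

theorem integral_selfAverage {m : Measure ℝ} (hm : IsConvexLaw m) :
    ∫ x, x ∂(selfAverage m) = ∫ x, x ∂m := by
  have := hm.isProb
  have hi := hm.integrable
  rw [selfAverage, integral_map (f := fun x : ℝ => x) (by fun_prop) aestronglyMeasurable_id]
  have h1 : Integrable (fun y : ℝ × ℝ => y.1) (m.prod m) := hi.comp_fst m
  have h2 : Integrable (fun y : ℝ × ℝ => y.2) (m.prod m) := hi.comp_snd m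
  simp only [div_eq_mul_inv]
  rw [integral_mul_const, integral_add h1 h2, integral_fun_fst (fun x : ℝ => x),
    integral_fun_snd (fun x : ℝ => x)]
  simp
  ring

theorem IsConvexLaw.integrable_sub_sq {m : Measure ℝ} (hm : IsConvexLaw m) (c : ℝ) :
    Integrable (fun x => (x - c) ^ 2) m := by
  have := hm.isProb
  obtain ⟨C, hC⟩ := hm.bounded
  refine .of_bound (by fun_prop) ((C + |c|) ^ 2) ?_
  filter_upwards [hC] with x hx
  rw [Real.norm_of_nonneg (sq_nonneg _), ← sq_abs]
  exact pow_le_pow_left₀ (abs_nonneg _) ((abs_sub _ _).trans (by gcongr)) 2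

/-- The cross term vanishes because the two copies are independent and centred at `c`. -/
theorem integral_sq_selfAverage {m : Measure ℝ} (hm : IsConvexLaw m) {c : ℝ}
    (hc : ∫ x, x ∂m = c) :
    ∫ x, (x - c) ^ 2 ∂(selfAverage m) = (∫ x, (x - c) ^ 2 ∂m) / 2 := by
  have := hm.isProb
  have hi : Integrable (fun x => x - c) m := hm.integrable.sub (integrable_const c)
  have hi0 : ∫ x, (x - c) ∂m = 0 := by
    rw [integral_sub hm.integrable (integrable_const c), hc]
    simp
  have hsq := hm.integrable_sub_sq c
  have h1 : Integrable (fun y : ℝ × ℝ => (y.1 - c) ^ 2) (m.prod m) := hsq.comp_fst m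
  have h2 : Integrable (fun y : ℝ × ℝ => (y.2 - c) ^ 2) (m.prod m) := hsq.comp_snd m
  have h3 : Integrable (fun y : ℝ × ℝ => (y.1 - c) * (y.2 - c)) (m.prod m) := hi.mul_prod hi
  have hexp : ∀ y : ℝ × ℝ, ((y.1 + y.2) / 2 - c) ^ 2 =
      (1 / 4) * (y.1 - c) ^ 2 + (1 / 4) * (y.2 - c) ^ 2 + (1 / 2) * ((y.1 - c) * (y.2 - c)) := by
    intro y; ring
  have h12 : Integrable
      (fun y : ℝ × ℝ => (1 / 4) * (y.1 - c) ^ 2 + (1 / 4) * (y.2 - c) ^ 2) (m.prod m) :=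
    (h1.const_mul _).add (h2.const_mul _)
  rw [selfAverage, integral_map (by fun_prop) (by fun_prop)]
  simp only [hexp]
  rw [integral_add h12 (h3.const_mul _),
    integral_add (h1.const_mul _) (h2.const_mul _), integral_const_mul, integral_const_mul,
    integral_const_mul, integral_fun_fst (fun x : ℝ => (x - c) ^ 2),
    integral_fun_snd (fun x : ℝ => (x - c) ^ 2),
    integral_prod_mul (fun x : ℝ => x - c) (fun x : ℝ => x - c), hi0]
  simp
  ring

theorem wasserstein1_dirac_le {m : Measure ℝ} (hm : IsConvexLaw m) (c : ℝ) :
    wasserstein1 m (Measure.dirac c) ≤ Real.sqrt (∫ x, (x - c) ^ 2 ∂m) := by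
  have := hm.isProb
  rw [wasserstein1_dirac]
  refine Real.le_sqrt_of_sq_le ?_
  set a := ∫ x, |x - c| ∂m with ha
  have hi : Integrable (fun x => |x - c|) m := (hm.integrable.sub (integrable_const c)).abs
  have hsq := hm.integrable_sub_sq c
  -- Nonnegativity of the variance of |x - c| gives the comparison of the L¹ and L² norms.
  have h : 0 ≤ ∫ x, (|x - c| - a) ^ 2 ∂m := integral_nonneg fun _ => sq_nonneg _
  have hexp : ∀ x : ℝ, (|x - c| - a) ^ 2 = (x - c) ^ 2 - (2 * a) * |x - c| + a ^ 2 := by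
    intro x
    rw [← sq_abs (x - c)]
    ring
  have hsub : Integrable (fun x => (x - c) ^ 2 - (2 * a) * |x - c|) m :=
    hsq.sub (hi.const_mul _)
  simp only [hexp] at h
  rw [integral_add hsub (integrable_const _),
    integral_sub hsq (hi.const_mul _), integral_const_mul, ← ha] at h
  simp only [integral_const, probReal_univ, one_smul] at h
  nlinarith

/-! ### Evaluation forces the expectation -/

variable {ρ : RiskMeasure} {k : KernelModel}

theorem prod_dirac_map (m : Measure ℝ) [SFinite m] (x : ℝ) {f : ℝ × ℝ → ℝ} (hf : Measurable f) :
    (m.prod (Measure.dirac x)).map f = m.map fun y => f (y, x) := by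
  rw [Measure.prod_dirac, Measure.map_map hf (by fun_prop)]
  rfl

/-- A displaced constant gives ρ on constants a whole interval of periods, so it is constant there.
The functional equation writes any ρ(m) as a value at a constant, so ρ is constant everywhere. -/
theorem RiskMeasure.SingleActionEvaluation.onLaw_eq_of_not_fixed (h : ρ.SingleActionEvaluation k)
    (hρ : ρ.LawInvariant) {x : ℝ} (hx : ρ.onLaw (Measure.dirac x) ≠ x) {m : Measure ℝ}
    (hm : IsConvexLaw m) : ρ.onLaw m = ρ.onLaw (Measure.dirac 0) := by
  set f : ℝ → ℝ := fun y => ρ.onLaw (Measure.dirac y) with hf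
  have hperiod : ∀ (y γ : ℝ), 0 ≤ γ → γ < 1 → f (y + γ * (f x - x)) = f y := by
    intro y γ h0 h1
    -- The reward is chosen so that the averaged variable is the constant y, while the Bellman side
    -- is y + γ(f x - x).
    have hK := (h.onLaw_average hρ h0 h1 (y - γ * x) (isConvexLaw_dirac x)
      (isConvexLaw_dirac x)).2
    have hmap : (Measure.dirac x).map (fun z => y - γ * x + γ * ((z + x) / 2)) =
        Measure.dirac (y - γ * x + γ * ((x + x) / 2)) := Measure.map_dirac' (by fun_prop) x
    rw [prod_dirac_map _ _ (by fun_prop), hmap] at hK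
    refine Eq.trans (congrArg f ?_) (hK.symm.trans (congrArg f ?_))
    · change _ = y - γ * x + γ * ((f x + f x) / 2)
      ring
    · ring
  have hconst : ∀ y, f y = f 0 := by
    intro y
    have hd : f x - x ≠ 0 := sub_ne_zero.2 hx
    have hnat : ∀ (γ : ℝ), 0 ≤ γ → γ < 1 → ∀ (n : ℕ) (z : ℝ), f (z + n * (γ * (f x - x))) = f z := by
      intro γ h0 h1 n z
      induction n with
      | zero => simp
      | succ n ih =>
        rw [← ih, ← hperiod (z + n * (γ * (f x - x))) γ h0 h1]
        congr 1
        push_cast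
        ring
    -- Periods are limited by γ < 1, so the distance from 0 to y is covered in n equal steps; the
    -- sign of y / (f x - x) decides whether they start from 0 or from y.
    obtain ⟨n, hn⟩ := exists_nat_gt (|y / (f x - x)|)
    have hn0 : (0 : ℝ) < n := (abs_nonneg _).trans_lt hn
    have hγ : |y / (f x - x)| / n < 1 := (div_lt_one hn0).2 hn
    have hγ0 : 0 ≤ |y / (f x - x)| / n := by positivity
    rcases le_total 0 (y / (f x - x)) with hs | hs
    · have := hnat _ hγ0 hγ n 0
      rw [abs_of_nonneg hs] at this
      rw [← this]
      congr 1
      field_simp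
      ring
    · have := hnat _ hγ0 hγ n y
      rw [abs_of_nonpos hs] at this
      rw [← this]
      congr 1
      field_simp
      ring
  -- Averaging with 0 and discounting by 1/2 divides by 4, so scaling by 4 first recovers `m`.
  have hm4 : IsConvexLaw (m.map fun y => 4 * y) := hm.map (by fun_prop)
  have := hm.isProb
  have := hm4.isProb
  have hK := (h.onLaw_average hρ (γ := 1 / 2) (by norm_num) (by norm_num) 0 hm4
    (isConvexLaw_dirac 0)).2
  rw [prod_dirac_map _ _ (by fun_prop), Measure.map_map (by fun_prop) (by fun_prop)] at hK
  have hid : ((fun y : ℝ => 0 + 1 / 2 * ((y + 0) / 2)) ∘ fun y => 4 * y) = id := by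
    funext y
    simp only [Function.comp, id]
    ring
  have hid' : m.map ((fun y : ℝ => 0 + 1 / 2 * ((y + 0) / 2)) ∘ fun y => 4 * y) = m := by
    rw [hid, Measure.map_id]
  exact (congrArg ρ.onLaw hid'.symm).trans (hK.trans (hconst _))

theorem RiskMeasure.SingleActionEvaluation.onLaw_dirac (h : ρ.SingleActionEvaluation k)
    (hρ : ρ.LawInvariant) (hn : ρ.NonConstant) (x : ℝ) : ρ.onLaw (Measure.dirac x) = x := by
  by_contra hx
  obtain ⟨m, m', hm, hm', hne⟩ := hn.exists_onLaw_ne hρ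
  exact hne ((h.onLaw_eq_of_not_fixed hρ hx hm).trans (h.onLaw_eq_of_not_fixed hρ hx hm').symm)

/-- A discounted average is the law of a value; multiplying by 2 undoes the discount 1/2. -/
theorem RiskMeasure.SingleActionEvaluation.isConvexLaw_selfAverage
    (h : ρ.SingleActionEvaluation k) (hρ : ρ.LawInvariant) {m : Measure ℝ} (hm : IsConvexLaw m) :
    IsConvexLaw (selfAverage m) := by
  have hK := (h.onLaw_average hρ (γ := 1 / 2) (by norm_num) (by norm_num) 0 hm hm).1.map
    (f := fun x => 2 * x) (by fun_prop)
  rw [Measure.map_map (by fun_prop) (by fun_prop)] at hK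
  have hfun : ((fun x : ℝ => 2 * x) ∘ fun y : ℝ × ℝ => 0 + 1 / 2 * ((y.1 + y.2) / 2)) =
      fun y => (y.1 + y.2) / 2 := by
    funext y
    simp only [Function.comp]
    ring
  rwa [hfun] at hK

/-- Since γ = 1 is excluded, the law of (X + X')/8 is obtained in two ways: from the self-average
and 0 with γ = 1/2, and from two copies of X with γ = 1/4. The two values, one quarter of ρ of the
self-average and one quarter of ρ(X), must agree. -/
theorem RiskMeasure.SingleActionEvaluation.onLaw_selfAverage (h : ρ.SingleActionEvaluation k)
    (hρ : ρ.LawInvariant) (hn : ρ.NonConstant) {m : Measure ℝ} (hm : IsConvexLaw m) :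
    ρ.onLaw (selfAverage m) = ρ.onLaw m := by
  have hid := h.onLaw_dirac hρ hn
  have hma := h.isConvexLaw_selfAverage hρ hm
  have := hm.isProb
  have := hma.isProb
  have h1 := (h.onLaw_average hρ (γ := 1 / 2) (by norm_num) (by norm_num) 0 hma
    (isConvexLaw_dirac 0)).2
  have h2 := (h.onLaw_average hρ (γ := 1 / 4) (by norm_num) (by norm_num) 0 hm hm).2
  rw [prod_dirac_map _ _ (by fun_prop), selfAverage, Measure.map_map (by fun_prop) (by fun_prop),
    ← selfAverage, hid, hid] at h1
  rw [hid] at h2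
  have hfun : ((fun y : ℝ => 0 + 1 / 2 * ((y + 0) / 2)) ∘ fun y : ℝ × ℝ => (y.1 + y.2) / 2) =
      fun y => 0 + 1 / 4 * ((y.1 + y.2) / 2) := by
    funext y
    simp only [Function.comp]
    ring
  have h3 := (congrArg (fun g => ρ.onLaw ((m.prod m).map g)) hfun).symm.trans h1
  have h4 := h2.symm.trans h3
  linarith

/-- A law of large numbers along dyadic averages: ρ is unchanged at each stage, while the variance
bound drives the laws to the point mass at the mean in W¹. -/
theorem RiskMeasure.SingleActionEvaluation.isExpectation (h : ρ.SingleActionEvaluation k)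
    (hρ : ρ.LawInvariant) (hn : ρ.NonConstant) (hc : ρ.W1Continuous) : ρ.IsExpectation := by
  intro M X hX
  rw [hρ.eq_onLaw hX, X.expectation_eq]
  set m := X.dist
  set c := ∫ x, x ∂m with hc'
  let a : ℕ → Measure ℝ := fun n => selfAverage^[n] m
  have ha : ∀ n, a (n + 1) = selfAverage (a n) := fun n => Function.iterate_succ_apply' _ _ _
  have hlaw : ∀ n, IsConvexLaw (a n) := by
    intro n
    induction n with
    | zero => exact hX.isConvexLaw
    | succ n ih => rw [ha]; exact h.isConvexLaw_selfAverage hρ ih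
  have hmean : ∀ n, ∫ x, x ∂(a n) = c := by
    intro n
    induction n with
    | zero => rfl
    | succ n ih => rw [ha, integral_selfAverage (hlaw n), ih]
  have hvar : ∀ n, ∫ x, (x - c) ^ 2 ∂(a n) = (∫ x, (x - c) ^ 2 ∂m) * (1 / 2) ^ n := by
    intro n
    induction n with
    | zero => simp [a]
    | succ n ih => rw [ha, integral_sq_selfAverage (hlaw n) (hmean n), ih, pow_succ]; ring
  have hval : ∀ n, ρ.onLaw (a n) = ρ.onLaw m := by
    intro n
    induction n with
    | zero => rfl
    | succ n ih => rw [ha, h.onLaw_selfAverage hρ hn (hlaw n), ih]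
  have hlim0 : Tendsto (fun n => Real.sqrt ((∫ x, (x - c) ^ 2 ∂m) * (1 / 2) ^ n)) atTop (𝓝 0) := by
    have := ((tendsto_pow_atTop_nhds_zero_of_lt_one (r := (1 / 2 : ℝ)) (by norm_num)
      (by norm_num)).const_mul (∫ x, (x - c) ^ 2 ∂m)).sqrt
    simpa using this
  have hW : Tendsto (fun n => wasserstein1 (a n) (Measure.dirac c)) atTop (𝓝 0) := by
    refine squeeze_zero (fun n => ?_) (fun n => ?_) hlim0
    · rw [wasserstein1_eq]
      exact integral_nonneg fun _ => abs_nonneg _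
    · rw [← hvar]
      exact wasserstein1_dirac_le (hlaw n) c
  have hlim := hc.tendsto_onLaw hρ hlaw (isConvexLaw_dirac c) hW
  simp only [hval, h.onLaw_dirac hρ hn] at hlim
  exact tendsto_nhds_unique tendsto_const_nhds hlim

/-! ### The expectation fails the Bellman equation for static kernels -/

/-- The uniform law on the unit interval. -/
def uniformLaw : Measure ℝ := volume.restrict (Set.Ioc 0 1)

instance : IsProbabilityMeasure uniformLaw := ⟨by simp [uniformLaw]⟩

theorem ae_uniformLaw : ∀ᵐ q ∂uniformLaw, q ∈ Set.Icc (0 : ℝ) 1 := by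
  filter_upwards [ae_restrict_mem (μ := volume) measurableSet_Ioc] with q hq
  exact ⟨hq.1.le, hq.2⟩

theorem convex_support_uniformLaw : Convex ℝ uniformLaw.support := by
  have hsub : Set.Ioo (0 : ℝ) 1 ⊆ uniformLaw.support := by
    refine Set.Subset.trans ?_ Measure.interior_inter_support
    rw [interior_Ioc, Measure.support_eq_univ, Set.inter_univ]
  have hsup : uniformLaw.support ⊆ Set.Icc 0 1 :=
    Measure.support_subset_of_isClosed isClosed_Icc ae_uniformLaw
  have heq : uniformLaw.support = Set.Icc 0 1 := by
    refine hsup.antisymm ?_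
    rw [← closure_Ioo zero_ne_one]
    exact closure_minimal hsub Measure.isClosed_support
  rw [heq]
  exact convex_Icc 0 1

theorem integral_pow_uniformLaw (n : ℕ) : ∫ q, q ^ n ∂uniformLaw = 1 / (n + 1) := by
  rw [uniformLaw, ← intervalIntegral.integral_of_le zero_le_one, integral_pow]
  simp

/-- The first successors in the looping instance. -/
def loopLeft : Fin 2 → Fin 2 := ![1, 1]

/-- The second successors in the looping instance. -/
def loopRight : Fin 2 → Fin 2 := ![0, 1]

/-- The rewards of the looping instance. -/
def loopReward : Fin 2 → Fin 2 → ℝ := ![![1, 0], ![0, 0]]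

/-- With discount 1/2 and reward 1 for each return to state 0, the value is q/(1 - q/2) with q
uniform. The Bellman equation would give v = (1 + v/2)/2, that is v = 2/3, but the true mean is
larger. -/
theorem RiskMeasure.IsExpectation.not_singleActionEvaluation_static (hρ : ρ.IsExpectation) :
    ¬ ρ.SingleActionEvaluation .static := by
  intro h
  have h0 : (0 : ℝ) ≤ 1 / 2 := by norm_num
  have h1 : (1 / 2 : ℝ) < 1 := by norm_num
  let m : Fin 2 → Measure ℝ := fun _ => uniformLaw
  let ν := splitLaw loopLeft loopRight m
  let D := singleActionMDP (0 : Fin 2) loopReward h0 h1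
  let π : StationaryPolicy (Fin 2) Unit := fun _ => stdSimplex.vertex (() : Unit)
  have hm : ∀ s, ∀ᵐ q ∂(m s), q ∈ Set.Icc (0 : ℝ) 1 := fun _ => ae_uniformLaw
  have hν : HasConvexSupport ν :=
    hasConvexSupport_splitLaw _ _ m hm fun _ => convex_support_uniformLaw
  have hprob : IsProbabilityMeasure ν :=
    inferInstanceAs (IsProbabilityMeasure (splitLaw loopLeft loopRight m))
  let ν' : Measure (TransKernel D.S D.A) := ν
  have hprob' : IsProbabilityMeasure ν' := hprob
  have hA : Subsingleton D.A := inferInstanceAs (Subsingleton Unit)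
  have heq := h D ν' hA hν
    (hasProductStructure_splitLaw _ _ m) π
  let V : Fin 2 → (ℕ → TransKernel (Fin 2) Unit) → ℝ := fun s P =>
    nominalValue (1 / 2) D.r (StationaryPolicy.toHistory (S := D.S) (A := D.A) π) P s
  let q : (ℕ → TransKernel (Fin 2) Unit) → ℝ := fun P => P 0 0 () 0
  have hq : Measurable q :=
    (measurable_kernel_apply 0 () 0).comp
      (measurable_pi_apply (X := fun _ => TransKernel (Fin 2) Unit) 0)
  let μ := KernelModel.static.pathLaw ν
  have hμ : IsProbabilityMeasure μ := inferInstanceAs (IsProbabilityMeasure (KernelModel.pathLaw _ ν))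
  have hqlaw : μ.map q = uniformLaw :=
    map_pathLaw_apply loopLeft loopRight m .static 0 hm (s := 0)
      (by simp [loopLeft, loopRight]) ()
  have hsplit : ∀ᵐ P ∂μ, ∀ n, IsSplit loopLeft loopRight (P n) :=
    ae_pathLaw_isSplit loopLeft loopRight m .static
  -- Static sequences are invariant under the shift, which turns the recursion at state 0 into an
  -- equation for V 0 itself.
  have hstatic : ∀ᵐ P ∂μ, (fun n => P (n + 1)) = P := by
    refine (ae_map_iff (measurable_pi_lambda _ fun _ => measurable_id).aemeasurable
      ?_).2 (Eventually.of_forall fun P => rfl)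
    exact measurableSet_eq_fun (by fun_prop) measurable_id
  have hq0 : ∀ P, 0 ≤ q P := fun P => simplex_nonneg _ _
  have hq1 : ∀ P, q P ≤ 1 := fun P => kernel_apply_le_one _ _ _ _
  have hV1 : ∀ᵐ P ∂μ, V 1 P = 0 := by
    filter_upwards [hsplit] with P hP
    exact nominalValue_absorbing (S := Fin 2) (A := Unit) h0 h1 D.r _ hP rfl rfl (fun _ => rfl) ()
  have hV0 : ∀ᵐ P ∂μ, V 0 P = q P * (1 + 1 / 2 * V 0 P) := by
    filter_upwards [hsplit, hstatic, hV1] with P hP hP' hP1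
    have hrec := nominalValue_split (S := Fin 2) (A := Unit) h0 h1 D.r
      (StationaryPolicy.toHistory (S := D.S) (A := D.A) π) (hP 0) (0 : Fin 2) ()
    rw [hP'] at hrec
    have hrec' : V 0 P = (1 - q P) * (0 + 1 / 2 * V 1 P) + q P * (1 + 1 / 2 * V 0 P) := hrec
    rw [hP1] at hrec'
    linarith
  have hvalue : ∀ s : Fin 2, (D.withKernels .static ν').value ρ
      (StationaryPolicy.toHistory (S := D.S) (A := D.A) π) s = ∫ P, V s P ∂μ := fun s =>
    hρ _ _ (convexSupport_valueRV D .static hν _ s)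
  have hmoment : ∀ n : ℕ, ∫ P, q P ^ n ∂μ = 1 / (n + 1) := fun n => by
    rw [← integral_pow_uniformLaw, ← hqlaw,
      integral_map hq.aemeasurable (by fun_prop : Continuous fun x : ℝ => x ^ n).aestronglyMeasurable]
  have hqint : ∀ n : ℕ, Integrable (fun P => q P ^ n) μ := fun n => by
    refine .of_bound (hq.pow_const n).aestronglyMeasurable 1 (Eventually.of_forall fun P => ?_)
    rw [Real.norm_of_nonneg (pow_nonneg (hq0 P) n)]
    exact pow_le_one₀ (hq0 P) (hq1 P)
  set v := ∫ P, V 0 P ∂μ with hv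
  have hv1 : ∫ P, V 1 P ∂μ = 0 := by
    rw [integral_congr_ae (g := fun _ => (0 : ℝ)) hV1, integral_zero]
  have hbell : (D.withKernels .static ν').bellman ρ π ((D.withKernels .static ν').value ρ
      (StationaryPolicy.toHistory (S := D.S) (A := D.A) π)) (0 : Fin 2) =
      ∫ P, q P ^ 1 * (1 + 1 / 2 * v) ∂μ := by
    refine (hρ _ _ (convexSupport_bellmanRV D .static hν π _ (0 : Fin 2))).trans ?_
    refine integral_congr_ae ?_
    filter_upwards [hsplit] with P hP
    refine (nominalBellman_split (S := Fin 2) (A := Unit) (1 / 2) D.r π (hP 0) _ 0 ()).trans ?_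
    have e0 := (hvalue 0).trans hv.symm
    have e1 := (hvalue 1).trans hv1
    refine Eq.trans (b := (1 - q P) * (0 + 1 / 2 * (D.withKernels .static ν').value ρ
      (StationaryPolicy.toHistory (S := D.S) (A := D.A) π) (1 : Fin 2)) +
      q P * (1 + 1 / 2 * (D.withKernels .static ν').value ρ
      (StationaryPolicy.toHistory (S := D.S) (A := D.A) π) (0 : Fin 2))) rfl ?_
    rw [e0, e1]
    ring
  have hmean := (hvalue 0).symm.trans ((congrFun heq (0 : Fin 2)).trans hbell)
  rw [integral_mul_const, hmoment] at hmean
  -- Three terms of the geometric expansion of q/(1 - q/2) are needed: the first two have mean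
  -- exactly 2/3, and the third raises the bound to 35/48.
  have hlow : ∫ P, (q P ^ 1 + 1 / 2 * q P ^ 2 + 1 / 4 * q P ^ 3) ∂μ ≤ v := by
    refine integral_mono_ae (((hqint 1).add ((hqint 2).const_mul _)).add ((hqint 3).const_mul _))
      (integrable_nominalValue (S := Fin 2) (A := Unit) h0 h1 D.r _ 0 μ) ?_
    filter_upwards [hV0] with P hP
    change q P ^ 1 + 1 / 2 * q P ^ 2 + 1 / 4 * q P ^ 3 ≤ V 0 P
    have h4 : (V 0 P - (q P ^ 1 + 1 / 2 * q P ^ 2 + 1 / 4 * q P ^ 3)) * (1 - q P / 2) =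
        q P ^ 4 / 8 := by linear_combination hP
    have hpos : 0 < 1 - q P / 2 := by linarith [hq1 P]
    have h5 : 0 ≤ (V 0 P - (q P ^ 1 + 1 / 2 * q P ^ 2 + 1 / 4 * q P ^ 3)) * (1 - q P / 2) := by
      rw [h4]
      have := pow_nonneg (hq0 P) 4
      positivity
    linarith [nonneg_of_mul_nonneg_left h5 hpos]
  have h12 : Integrable (fun P => q P ^ 1 + 1 / 2 * q P ^ 2) μ :=
    (hqint 1).add ((hqint 2).const_mul _)
  rw [integral_add h12 ((hqint 3).const_mul _), integral_add (hqint 1) ((hqint 2).const_mul _),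
    integral_const_mul, integral_const_mul, hmoment, hmoment, hmoment] at hlow
  norm_num at hlow hmean
  linarith

end

end AmbiguityAverse

theorem mainTheorem2 :
    (∀ ρ : AmbiguityAverse.RiskMeasure,
      ρ.LawInvariant → ρ.NonConstant → ρ.W1Continuous →
        ¬ ρ.PolicyEvaluation .static ∧ ¬ ρ.PolicyOptimization .static) ∧
    (∀ ρ : AmbiguityAverse.RiskMeasure,
      (ρ.LawInvariant ∧ ρ.NonConstant ∧ ρ.W1Continuous ∧ ρ.PolicyEvaluation .resampled) ↔
        ρ.IsExpectation) ∧
    (∀ ρ : AmbiguityAverse.RiskMeasure,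
      (ρ.LawInvariant ∧ ρ.NonConstant ∧ ρ.W1Continuous ∧ ρ.PolicyOptimization .resampled) ↔
        ρ.IsExpectation) := by
  refine ⟨fun ρ hl hn hc => ⟨fun h => ?_, fun h => ?_⟩, fun ρ => ⟨?_, fun h => ?_⟩,
    fun ρ => ⟨?_, fun h => ?_⟩⟩
  · exact (h.singleAction.isExpectation hl hn hc).not_singleActionEvaluation_static h.singleAction
  · exact (h.singleAction.isExpectation hl hn hc).not_singleActionEvaluation_static h.singleAction
  · rintro ⟨hl, hn, hc, h⟩
    exact h.singleAction.isExpectation hl hn hc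
  · exact ⟨h.lawInvariant, h.nonConstant, h.w1Continuous, h.policyEvaluation⟩
  · rintro ⟨hl, hn, hc, h⟩
    exact h.singleAction.isExpectation hl hn hc
  · exact ⟨h.lawInvariant, h.nonConstant, h.w1Continuous, h.policyOptimization⟩
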